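/- Let $a,b,c,d$ be nonnegative integers with $a+b=c+d=:S$ and $bc\neq 0$; put $m=a-c$ and $\sigma=m/S$, and assume $\sigma>\tfrac12$. Consider the two-color Pólya urn in discrete time with replacement matrix $R=\begin{pmatrix}a&b\\c&d\end{pmatrix}$: at each step a ball is drawn uniformly from the urn and put back, together with $a$ red and $b$ black balls if it is red, and with $c$ red and $d$ black balls if it is black. For $(\alpha,\beta)\in\mathbb N^2\setminus\{(0,0)\}$ let $U_{(\alpha,\beta)}(n)=(x_n,y_n)$ be the composition vector (numbers of red and of black balls) at time $n$ of the urn that starts with $\alpha$ red and $\beta$ black balls, and let $u_2(x,y)=\frac1S(bx-cy)$. (1) For every $(\alpha,\beta)\in\mathbb N^2\setminus\{(0,0)\}$ the real limit $$W_{(\alpha,\beta)}=\lim_{n\to\infty}\frac{1}{n^{\sigma}}\,u_2\big(U_{(\alpha,\beta)}(n)\big)$$ exists almost surely. (2) For every $(\alpha,\beta)\in\mathbb N^2\setminus\{(0,0)\}$, $$W_{(\alpha,\beta)}\ \overset{\mathcal L}{=}\ \sum_{k=1}^{\alpha}Z_k^{\sigma}\,W_{(1,0)}^{(k)}+\sum_{k=\alpha+1}^{\alpha+\beta}Z_k^{\sigma}\,W_{(0,1)}^{(k)},$$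 where $Z=(Z_1,\dots,Z_{\alpha+\beta})$ is a Dirichlet distributed random vector with parameters $(\frac1S,\dots,\frac1S)$ (when $\alpha+\beta=1$, this means $Z_1=1$ almost surely), the random variables $W_{(1,0)}^{(k)}$ and $W_{(0,1)}^{(k)}$ are copies of $W_{(1,0)}$ and of $W_{(0,1)}$ respectively, and all of them are independent of each other and of $Z$. -/

import Mathlib

open MeasureTheory ProbabilityTheory Filter Topology
open scoped ENNReal

noncomputable section

namespace PolyaUrn

/-- The law of the next composition, when an urn with replacement matrix `(a b; c d)` contains `v.1`
red and `v.2` black balls: a ball is drawn uniformly, so it is red with probability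
`v.1 / (v.1 + v.2)` and black with probability `v.2 / (v.1 + v.2)`; it is put back together with
`a` red and `b` black balls in the first case, `c` red and `d` black balls in the second one.
By convention an empty urn stays empty. -/
def stepMeasure (a b c d : ℕ) (v : ℕ × ℕ) : Measure (ℕ × ℕ) :=
  if v = (0, 0) then Measure.dirac v
  else ((v.1 : ℝ≥0∞) / (v.1 + v.2)) • Measure.dirac (v.1 + a, v.2 + b)
    + ((v.2 : ℝ≥0∞) / (v.1 + v.2)) • Measure.dirac (v.1 + c, v.2 + d)

/-- The one-step transition kernel of the urn. -/
def stepKernel (a b c d : ℕ) : Kernel (ℕ × ℕ) (ℕ × ℕ) :=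
  Kernel.ofFunOfCountable (stepMeasure a b c d)

instance (a b c d : ℕ) : IsMarkovKernel (stepKernel a b c d) := by
  refine ⟨fun v => ⟨?_⟩⟩
  change stepMeasure a b c d v Set.univ = 1
  unfold stepMeasure
  split_ifs with h
  · simp
  · simp only [Measure.coe_add, Measure.coe_smul, Pi.add_apply, Pi.smul_apply, measure_univ,
      smul_eq_mul, mul_one]
    rw [← ENNReal.add_div]
    refine ENNReal.div_self ?_ (by finiteness)
    intro h0
    apply h
    ext <;> simp_all

/-- The transition kernel that gives the composition at time `n + 1` from the compositions at the
times `0, …, n`; it depends only on the composition at time `n`. -/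
def historyKernel (a b c d n : ℕ) : Kernel (Finset.Iic n → ℕ × ℕ) (ℕ × ℕ) :=
  (stepKernel a b c d).comap (fun x => x ⟨n, Finset.mem_Iic.2 le_rfl⟩) (measurable_pi_apply _)

instance (a b c d n : ℕ) : IsMarkovKernel (historyKernel a b c d n) := by
  unfold historyKernel
  infer_instance

/-- The law, on the space of sequences of compositions `(red, black)`, of the discrete-time urn
process `(U(n))_{n ≥ 0}` with replacement matrix `(a b; c d)` and initial composition `(α, β)`. -/
def urnLaw (a b c d α β : ℕ) : Measure (ℕ → ℕ × ℕ) :=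
  Kernel.trajMeasure (X := fun _ => ℕ × ℕ) (Measure.dirac (α, β)) (historyKernel a b c d)

/-- The ratio `σ = m / S` of the eigenvalues `m = a - c` and `S = a + b` of the replacement
matrix. -/
def ratio (a b c : ℕ) : ℝ := ((a : ℝ) - c) / ((a : ℝ) + b)

/-- The eigenform `u₂(x, y) = (b x - c y) / S`, where `S = a + b`. -/
def u₂ (a b c : ℕ) (v : ℕ × ℕ) : ℝ := ((b : ℝ) * v.1 - (c : ℝ) * v.2) / ((a : ℝ) + b)

/-- The rescaled second projection `n^(-σ) u₂(U(n))` of a trajectory `U`. -/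
def scaled (a b c : ℕ) (U : ℕ → ℕ × ℕ) (n : ℕ) : ℝ := u₂ a b c (U n) / (n : ℝ) ^ ratio a b c

/-- The law of `W_(α,β) = lim n^(-σ) u₂(U_(α,β)(n))`. (The theorem asserts that this limit exists
almost surely.) -/
def limitLaw (a b c d α β : ℕ) : Measure ℝ :=
  (urnLaw a b c d α β).map (fun U => limUnder atTop (scaled a b c U))

/-- The point `(x₁, …, xₙ, 1 - ∑ xᵢ)` of the hyperplane `∑ xᵢ = 1` over `(x₁, …, xₙ)`. -/
def simplexPoint {n : ℕ} (x : Fin n → ℝ) : Fin (n + 1) → ℝ :=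
  Fin.snoc (α := fun _ => ℝ) x (1 - ∑ i, x i)

open scoped Classical in
/-- The Dirichlet distribution with parameters `ν₁, …, ν_d` (positive reals, `d ≥ 1`): the
probability measure on the simplex with density
`Γ(ν₁ + ⋯ + ν_d) / (Γ(ν₁) ⋯ Γ(ν_d)) * ∏ x_k ^ (ν_k - 1)` with respect to the Lebesgue measure
`dx₁ ⋯ dx_{d-1}`. For `d = 1` this is the Dirac mass at the point `1`. There is no Dirichlet
distribution for `d = 0`, where the value is the zero measure. -/
def dirichlet : (d : ℕ) → (Fin d → ℝ) → Measure (Fin d → ℝ)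
  | 0, _ => 0
  | n + 1, ν =>
    ((volume : Measure (Fin n → ℝ)).withDensity fun x =>
      if (∀ i, 0 ≤ x i) ∧ ∑ i, x i ≤ 1 then
        ENNReal.ofReal (Real.Gamma (∑ k, ν k) / (∏ k, Real.Gamma (ν k))
          * ∏ k, simplexPoint x k ^ (ν k - 1))
      else 0).map simplexPoint

end PolyaUrn

end

namespace PolyaUrn

/-! Let τ be the number of balls divided by S; each draw raises it by exactly 1. The form u₂ is an
eigenvector of the mean step: one draw multiplies its expectation by 1 + σ/τ. Hence u₂(U n) /
∏_{k<n} (1 + σ/(τ + k)) is a martingale. Because σ > 1/2, a constant A exists for which the mean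
step multiplies u₂² + A τ by at most 1 + 2σ/τ. This bounds the martingale in L², so it converges,
and the product is asymptotic to n^σ Γ(τ)/Γ(τ + σ), which gives (1).

For (2) the core is the two-part identity `IsLarge.charFun_add`: W_(v+w) has the law of B^σ W_v + (1
- B)^σ W_w with B beta distributed with parameters τ(v), τ(w). It is proved by a uniqueness
argument. As functions of the pair (v, w), the characteristic functions of both sides are harmonic
for the urn in which the parts v and w are tracked separately: the left side by conditioning on the
first draw (`IsLarge.charFun_add_eq_pairMean`), the right side because x + (1 - x) = 1 splits the
beta density in the proportions of a draw (`IsLarge.splitFun_eq_pairMean`). Both laws have mean r =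
u₂(v+w) Γ(τ)/Γ(τ + σ), with τ = τ(v+w), and variance at most A τ Γ(τ)/Γ(τ + 2σ), of order τ^(1 -
2σ). So both characteristic functions are close to exp(i t r) once τ is large. Averaging their
difference over n draws and letting n tend to infinity shows that it vanishes.

Stick-breaking of the Dirichlet law (`dirichlet_eq_map_prod`) iterates the identity down to single
balls, and characteristic functions determine laws. -/

/-! ### Expectations and conditional expectations along the urn. -/

/-- The expectation of `f` after one step of the urn with composition `v`. -/
noncomputable def stepMean {E : Type*} [AddCommGroup E] [Module ℝ E] (a b c d : ℕ)
    (f : ℕ × ℕ → E) (v : ℕ × ℕ) : E :=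
  ((v.1 : ℝ) / (v.1 + v.2)) • f (v.1 + a, v.2 + b)
    + ((v.2 : ℝ) / (v.1 + v.2)) • f (v.1 + c, v.2 + d)

theorem cast_add_cast_pos {v : ℕ × ℕ} (hv : v ≠ 0) : 0 < (v.1 : ℝ) + v.2 := by
  have : 0 < v.1 + v.2 := by
    by_contra h
    apply hv
    ext <;> simp <;> omega
  exact_mod_cast this

theorem integral_stepKernel {E : Type*} [NormedAddCommGroup E] [NormedSpace ℝ E] [CompleteSpace E]
    (a b c d : ℕ) (f : ℕ × ℕ → E) {v : ℕ × ℕ} (hv : v ≠ 0) :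
    ∫ w, f w ∂(stepKernel a b c d v) = stepMean a b c d f v := by
  change ∫ w, f w ∂(stepMeasure a b c d v) = _
  have hv' : ¬ v = (0, 0) := hv
  have hpos := cast_add_cast_pos hv
  have hfin : ∀ k : ℕ, (k : ℝ≥0∞) / (v.1 + v.2) ≠ ∞ := fun k =>
    ENNReal.div_ne_top (by simp) (by exact_mod_cast hpos.ne')
  rw [stepMeasure, if_neg hv', integral_add_measure, integral_smul_measure,
    integral_smul_measure, integral_dirac, integral_dirac]
  · simp [stepMean, ENNReal.toReal_div, ENNReal.toReal_add]
  · exact (integrable_dirac (by simp)).smul_measure (hfin _)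
  · exact (integrable_dirac (by simp)).smul_measure (hfin _)

theorem stepKernel_ae_total {a b c d : ℕ} (hbal : a + b = c + d) {v : ℕ × ℕ} (hv : v ≠ 0) :
    ∀ᵐ w ∂(stepKernel a b c d v), w.1 + w.2 = v.1 + v.2 + (a + b) := by
  change ∀ᵐ w ∂(stepMeasure a b c d v), _
  have hv' : ¬ v = (0, 0) := hv
  rw [stepMeasure, if_neg hv', ae_add_measure_iff]
  constructor
  · refine Measure.ae_smul_measure ?_ _
    rw [ae_dirac_eq]
    change (v.1 + a + (v.2 + b)) = _
    ring
  · refine Measure.ae_smul_measure ?_ _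
    rw [ae_dirac_eq]
    change (v.1 + c + (v.2 + d)) = _
    omega

/-- The initial law is a Dirac mass, so results on trajectories started from a fixed point apply. -/
theorem urnLaw_eq_traj (a b c d α β : ℕ) :
    urnLaw a b c d α β =
      Kernel.traj (X := fun _ => ℕ × ℕ) (historyKernel a b c d) 0 (fun _ => (α, β)) := by
  unfold urnLaw Kernel.trajMeasure
  have h : (Measure.dirac (α, β)).map
      (MeasurableEquiv.piUnique (fun i : Finset.Iic 0 => (fun _ : ℕ => ℕ × ℕ) i)).symm =
        Measure.dirac (fun _ => (α, β)) :=
    Measure.map_dirac' (MeasurableEquiv.measurable _) _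
  exact (congrArg (Measure.bind · _) h).trans (Measure.dirac_bind (Kernel.measurable _) _)

instance (a b c d α β : ℕ) : IsProbabilityMeasure (urnLaw a b c d α β) := by
  unfold urnLaw
  infer_instance

theorem urnLaw_map_succ (a b c d α β n : ℕ) :
    (urnLaw a b c d α β).map (fun U => U (n + 1)) =
      stepKernel a b c d ∘ₘ (urnLaw a b c d α β).map (fun U => U n) := by
  have h := Kernel.map_frestrictLe_trajMeasure_compProd_eq_map_trajMeasure
    (X := fun _ => ℕ × ℕ) (μ₀ := Measure.dirac (α, β)) (κ := historyKernel a b c d) (a := n)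
  have h2 := congrArg Measure.snd h
  rw [Measure.snd_compProd, Measure.snd_map_prodMk (by fun_prop)] at h2
  refine h2.symm.trans ?_
  ext s hs
  rw [Measure.bind_apply hs (Kernel.aemeasurable _), Measure.bind_apply hs (Kernel.aemeasurable _),
    lintegral_map (Kernel.measurable_coe _ hs) (by fun_prop),
    lintegral_map (Kernel.measurable_coe _ hs) (by fun_prop)]
  rfl

theorem urnLaw_ae_zero (a b c d α β : ℕ) : ∀ᵐ U ∂(urnLaw a b c d α β), U 0 = (α, β) := by
  rw [urnLaw_eq_traj]
  have h := Kernel.traj_map_frestrictLe_apply (X := fun _ => ℕ × ℕ)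
    (κ := historyKernel a b c d) 0 0 (fun _ => (α, β))
  rw [Kernel.partialTraj_self, Kernel.id_apply] at h
  have h2 : ∀ᵐ x ∂((Kernel.traj (X := fun _ => ℕ × ℕ) (historyKernel a b c d) 0
      (fun _ => (α, β))).map (Preorder.frestrictLe 0)), x = fun _ => (α, β) := by
    rw [h, ae_dirac_eq]
    rfl
  have h3 := ae_of_ae_map (by fun_prop) h2
  filter_upwards [h3] with U hU
  exact congrFun hU ⟨0, by simp⟩

theorem urnLaw_ae_total {a b c d : ℕ} (hbal : a + b = c + d) {α β : ℕ} (h0 : (α, β) ≠ (0, 0))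
    (n : ℕ) : ∀ᵐ U ∂(urnLaw a b c d α β), (U n).1 + (U n).2 = α + β + n * (a + b) := by
  induction n with
  | zero =>
    filter_upwards [urnLaw_ae_zero a b c d α β] with U hU
    simp [hU]
  | succ n ih =>
    have hm : ∀ k, AEMeasurable (fun U : ℕ → ℕ × ℕ => U k) (urnLaw a b c d α β) :=
      fun k => (measurable_pi_apply k).aemeasurable
    refine ae_of_ae_map (hm (n + 1))
      (p := fun v : ℕ × ℕ => v.1 + v.2 = α + β + (n + 1) * (a + b)) ?_
    rw [urnLaw_map_succ]
    refine Measure.ae_comp_of_ae_ae (.of_discrete) ?_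
    rw [ae_map_iff (hm n) (.of_discrete)]
    filter_upwards [ih] with U hU
    have hv : U n ≠ 0 := by
      intro h
      rw [h] at hU
      apply h0
      simp at hU
      ext <;> simp <;> omega
    filter_upwards [stepKernel_ae_total hbal hv] with w hw
    rw [hw, hU]
    ring

theorem urnLaw_ae_ne_zero {a b c d : ℕ} (hbal : a + b = c + d) {α β : ℕ} (h0 : (α, β) ≠ (0, 0))
    (n : ℕ) : ∀ᵐ U ∂(urnLaw a b c d α β), U n ≠ 0 := by
  filter_upwards [urnLaw_ae_total hbal h0 n] with U hU h
  rw [h] at hU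
  apply h0
  simp at hU
  ext <;> simp <;> omega

section Integral

variable {E : Type*} [NormedAddCommGroup E]

/-- The number of balls at a given time is deterministic, so the composition takes finitely many
values. Every function of it is therefore integrable. -/
theorem exists_bound_of_total (f : ℕ × ℕ → E) (N : ℕ) :
    ∃ C, ∀ v : ℕ × ℕ, v.1 + v.2 = N → ‖f v‖ ≤ C := by
  refine ⟨∑ v ∈ Finset.HasAntidiagonal.antidiagonal N, ‖f v‖, fun v hv => ?_⟩
  exact Finset.single_le_sum (f := fun v => ‖f v‖) (fun _ _ => norm_nonneg _)
    (Finset.HasAntidiagonal.mem_antidiagonal.2 hv)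

theorem integrable_urnLaw {a b c d : ℕ} (hbal : a + b = c + d) {α β : ℕ} (h0 : (α, β) ≠ (0, 0))
    (f : ℕ × ℕ → E) (n : ℕ) : Integrable (fun U => f (U n)) (urnLaw a b c d α β) := by
  obtain ⟨C, hC⟩ := exists_bound_of_total f (α + β + n * (a + b))
  refine Integrable.of_bound (C := C) ?_ ?_
  · exact ((StronglyMeasurable.of_discrete (f := f)).comp_measurable
      (measurable_pi_apply n)).aestronglyMeasurable
  · filter_upwards [urnLaw_ae_total hbal h0 n] with U hU using hC _ hU

variable [NormedSpace ℝ E] [CompleteSpace E]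

theorem condExp_urnLaw {a b c d : ℕ} (hbal : a + b = c + d) {α β : ℕ} (h0 : (α, β) ≠ (0, 0))
    (f : ℕ × ℕ → E) (n : ℕ) :
    (urnLaw a b c d α β)[fun U => f (U (n + 1)) | Filtration.piLE (X := fun _ => ℕ × ℕ) n]
      =ᵐ[urnLaw a b c d α β] fun U => stepMean a b c d f (U n) := by
  have hi := integrable_urnLaw hbal h0 f (n + 1)
  have hz := urnLaw_ae_ne_zero hbal h0 n
  rw [urnLaw_eq_traj] at hi hz ⊢
  filter_upwards [Kernel.condExp_traj (Nat.zero_le n) hi, hz] with U hU hUz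
  rw [hU, ← integral_stepKernel a b c d f hUz]
  have h := Kernel.map_traj_succ_self (X := fun _ => ℕ × ℕ) (κ := historyKernel a b c d) (a := n)
  have h2 := congrArg (fun κ => κ (Preorder.frestrictLe n U)) h
  rw [Kernel.map_apply _ (by fun_prop)] at h2
  rw [← integral_map (φ := fun U : ℕ → ℕ × ℕ => U (n + 1)) (f := f)
    (measurable_pi_apply _).aemeasurable
    (StronglyMeasurable.of_discrete).aestronglyMeasurable, h2]
  rfl

theorem integral_urnLaw_succ {a b c d : ℕ} (hbal : a + b = c + d) {α β : ℕ}
    (h0 : (α, β) ≠ (0, 0)) (f : ℕ × ℕ → E) (n : ℕ) :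
    ∫ U, f (U (n + 1)) ∂(urnLaw a b c d α β) =
      ∫ U, stepMean a b c d f (U n) ∂(urnLaw a b c d α β) := by
  rw [← integral_condExp (Filtration.le (Filtration.piLE (X := fun _ => ℕ × ℕ)) n),
    integral_congr_ae (condExp_urnLaw hbal h0 f n)]

theorem integral_urnLaw {a b c d : ℕ} (hbal : a + b = c + d) {α β : ℕ}
    (h0 : (α, β) ≠ (0, 0)) (n : ℕ) (f : ℕ × ℕ → E) :
    ∫ U, f (U n) ∂(urnLaw a b c d α β) = (stepMean a b c d)^[n] f (α, β) := by
  induction n generalizing f with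
  | zero =>
    rw [integral_congr_ae (g := fun _ => f (α, β))]
    · simp
    · filter_upwards [urnLaw_ae_zero a b c d α β] with U hU
      rw [hU]
  | succ n ih => rw [integral_urnLaw_succ hbal h0, ih, Function.iterate_succ_apply]

/-- The first-step decomposition of the expectation. -/
theorem integral_urnLaw_succ' {a b c d : ℕ} (hbal : a + b = c + d) (hS : a ≠ 0) (hS' : d ≠ 0)
    {v : ℕ × ℕ} (h0 : v ≠ 0) (n : ℕ) (f : ℕ × ℕ → E) :
    ∫ U, f (U (n + 1)) ∂(urnLaw a b c d v.1 v.2) =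
      stepMean a b c d (fun w => ∫ U, f (U n) ∂(urnLaw a b c d w.1 w.2)) v := by
  -- Unfolding the iterate from the outside isolates the first draw; `integral_urnLaw_succ` isolates
  -- the last one.
  rw [integral_urnLaw hbal h0, Function.iterate_succ_apply']
  simp only [stepMean]
  rw [integral_urnLaw hbal (by simp [hS]), integral_urnLaw hbal (by simp [hS'])]

end Integral

/-- A balanced two-color urn with nonzero off-diagonal entries and `σ > 1/2`. -/
structure IsLarge (a b c d : ℕ) : Prop where
  bal : a + b = c + d
  b_ne : b ≠ 0
  c_ne : c ≠ 0
  large : 1 / 2 < ratio a b c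

theorem IsLarge.sum_pos {a b c d : ℕ} (h : IsLarge a b c d) : 0 < (a : ℝ) + b := by
  have : 0 < (b : ℝ) := by exact_mod_cast Nat.pos_of_ne_zero h.b_ne
  positivity

theorem IsLarge.ratio_pos {a b c d : ℕ} (h : IsLarge a b c d) : 0 < ratio a b c := by linarith [h.large]

theorem IsLarge.c_lt_a {a b c d : ℕ} (h : IsLarge a b c d) : c < a := by
  have h1 := h.ratio_pos
  rw [ratio, div_pos_iff_of_pos_right h.sum_pos, sub_pos] at h1
  exact_mod_cast h1

theorem IsLarge.a_ne {a b c d : ℕ} (h : IsLarge a b c d) : a ≠ 0 := by have := h.c_lt_a; omega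

theorem IsLarge.d_ne {a b c d : ℕ} (h : IsLarge a b c d) : d ≠ 0 := by have := h.c_lt_a; have := h.bal; omega


/-! ### Growth products and quotients of Gamma values. -/

/-- The number of balls divided by the balance `S = a + b`. -/
noncomputable def mass (a b : ℕ) (v : ℕ × ℕ) : ℝ := ((v.1 : ℝ) + v.2) / ((a : ℝ) + b)

/-- The product `∏_{k < n} (1 + s / (τ + k))`. -/
noncomputable def growth (s τ : ℝ) (n : ℕ) : ℝ := ∏ k ∈ Finset.range n, (1 + s / (τ + k))

/-- The quotient `Γ(τ) / Γ(τ + s)`. -/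
noncomputable def gammaRatio (s τ : ℝ) : ℝ := Real.Gamma τ / Real.Gamma (τ + s)

theorem growth_succ (s τ : ℝ) (n : ℕ) :
    growth s τ (n + 1) = growth s τ n * (1 + s / (τ + n)) := Finset.prod_range_succ _ _

theorem growth_pos {s τ : ℝ} (hs : 0 < s) (hτ : 0 < τ) (n : ℕ) : 0 < growth s τ n :=
  Finset.prod_pos fun k _ => by positivity

/-- Factorwise, 1 + 2x ≤ (1 + x)². It compares the natural normalization of second moments with the
square of that of first moments. -/
theorem growth_two_mul_le {s τ : ℝ} (hs : 0 < s) (hτ : 0 < τ) (n : ℕ) :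
    growth (2 * s) τ n ≤ growth s τ n ^ 2 := by
  rw [growth, growth, ← Finset.prod_pow]
  refine Finset.prod_le_prod (fun k _ => by positivity) fun k _ => ?_
  have : 2 * s / (τ + k) = 2 * (s / (τ + k)) := by ring
  rw [this]
  nlinarith [sq_nonneg (s / (τ + k))]

theorem gammaRatio_pos {s τ : ℝ} (hs : 0 < s) (hτ : 0 < τ) : 0 < gammaRatio s τ :=
  div_pos (Real.Gamma_pos_of_pos hτ) (Real.Gamma_pos_of_pos (by positivity))

theorem tendsto_growth {s τ : ℝ} (hs : 0 < s) (hτ : 0 < τ) :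
    Tendsto (fun n : ℕ => growth s τ n / (n : ℝ) ^ s) atTop (𝓝 (gammaRatio s τ)) := by
  have h1 : Tendsto (fun n : ℕ => Real.GammaSeq τ n / Real.GammaSeq (τ + s) n) atTop
      (𝓝 (gammaRatio s τ)) :=
    (Real.GammaSeq_tendsto_Gamma τ).div (Real.GammaSeq_tendsto_Gamma (τ + s))
      (Real.Gamma_pos_of_pos (by positivity)).ne'
  -- `Real.GammaSeq` has the factors j ≤ n while `growth` stops at j < n; this is the surplus
  -- factor.
  have h2 : Tendsto (fun n : ℕ => (τ + n) / (τ + s + n)) atTop (𝓝 1) := by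
    have h3 : Tendsto (fun n : ℕ => 1 - s / (τ + s + n)) atTop (𝓝 (1 - 0)) :=
      tendsto_const_nhds.sub (tendsto_const_nhds.div_atTop
        (tendsto_atTop_add_const_left _ _ tendsto_natCast_atTop_atTop))
    rw [sub_zero] at h3
    refine h3.congr fun n => ?_
    have : τ + s + n ≠ 0 := by positivity
    field_simp
    ring
  have h4 := h1.mul h2
  rw [mul_one] at h4
  refine h4.congr' ?_
  filter_upwards [eventually_gt_atTop 0] with n hn
  have hn' : (0 : ℝ) < n := by exact_mod_cast hn
  have hg : growth s τ n = (∏ j ∈ Finset.range n, (τ + s + j)) / ∏ j ∈ Finset.range n, (τ + j) := by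
    rw [growth, ← Finset.prod_div_distrib]
    refine Finset.prod_congr rfl fun k _ => ?_
    have : τ + k ≠ 0 := by positivity
    field_simp
    ring
  have p1 : (∏ j ∈ Finset.range n, (τ + s + (j : ℝ))) ≠ 0 :=
    (Finset.prod_pos fun k _ => by positivity).ne'
  have p2 : (∏ j ∈ Finset.range n, (τ + (j : ℝ))) ≠ 0 :=
    (Finset.prod_pos fun k _ => by positivity).ne'
  have p3 : τ + s + n ≠ 0 := by positivity
  have p4 : τ + n ≠ 0 := by positivity
  have p5 : (n : ℝ) ^ s ≠ 0 := by positivity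
  have p6 : (n : ℝ) ^ τ ≠ 0 := by positivity
  have p7 : ((n.factorial : ℕ) : ℝ) ≠ 0 := by positivity
  rw [hg, Real.GammaSeq, Real.GammaSeq, Real.rpow_add hn', Finset.prod_range_succ,
    Finset.prod_range_succ]
  field_simp

/-- Limit of `growth_two_mul_le`; it amounts to log-convexity of Γ at a midpoint. -/
theorem gammaRatio_two_mul_le {s τ : ℝ} (hs : 0 < s) (hτ : 0 < τ) :
    gammaRatio (2 * s) τ ≤ gammaRatio s τ ^ 2 := by
  have h1 := tendsto_growth (s := 2 * s) (by positivity) hτ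
  have h2 := (tendsto_growth hs hτ).pow 2
  refine le_of_tendsto_of_tendsto h1 h2 ?_
  filter_upwards with n
  rw [div_pow, mul_comm 2 s, Real.rpow_mul (by positivity), mul_comm s 2, Real.rpow_two]
  exact div_le_div_of_nonneg_right (growth_two_mul_le hs hτ n) (by positivity)

/-! ### First and second moments of the eigenform at time n. -/

section Mean

variable {a b c d : ℕ}

theorem IsLarge.mass_pos (h : IsLarge a b c d) {v : ℕ × ℕ} (hv : v ≠ 0) : 0 < mass a b v :=
  div_pos (cast_add_cast_pos hv) h.sum_pos

theorem IsLarge.mass_eq (h : IsLarge a b c d) {v w : ℕ × ℕ} {n : ℕ}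
    (hw : w.1 + w.2 = v.1 + v.2 + n * (a + b)) : mass a b w = mass a b v + n := by
  have := h.sum_pos
  have h2 : (w.1 : ℝ) + w.2 = v.1 + v.2 + n * (a + b) := by exact_mod_cast hw
  rw [mass, mass, h2]
  field_simp

theorem IsLarge.red_ne (h : IsLarge a b c d) (v : ℕ × ℕ) : (v.1 + a, v.2 + b) ≠ (0 : ℕ × ℕ) := by
  intro h0
  have h1 := congrArg Prod.fst h0
  have h2 := h.a_ne
  simp at h1
  omega

theorem IsLarge.black_ne (h : IsLarge a b c d) (v : ℕ × ℕ) :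
    (v.1 + c, v.2 + d) ≠ (0 : ℕ × ℕ) := by
  intro h0
  have h1 := congrArg Prod.fst h0
  have h2 := h.c_ne
  simp at h1
  omega

theorem IsLarge.mass_red (h : IsLarge a b c d) (v : ℕ × ℕ) :
    mass a b (v.1 + a, v.2 + b) = mass a b v + 1 := by
  have := h.mass_eq (v := v) (w := (v.1 + a, v.2 + b)) (n := 1) (by simp; ring)
  simpa using this

theorem IsLarge.mass_black (h : IsLarge a b c d) (v : ℕ × ℕ) :
    mass a b (v.1 + c, v.2 + d) = mass a b v + 1 := by
  have := h.mass_eq (v := v) (w := (v.1 + c, v.2 + d)) (n := 1) (by have := h.bal; simp; omega)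
  simpa using this

theorem IsLarge.bal_real (h : IsLarge a b c d) : (a : ℝ) + b = c + d := by exact_mod_cast h.bal

theorem IsLarge.u₂_red (h : IsLarge a b c d) (v : ℕ × ℕ) :
    u₂ a b c (v.1 + a, v.2 + b) = u₂ a b c v + ratio a b c * b := by
  have := h.sum_pos
  simp only [u₂, ratio]
  push_cast
  field_simp
  ring

theorem IsLarge.u₂_black (h : IsLarge a b c d) (v : ℕ × ℕ) :
    u₂ a b c (v.1 + c, v.2 + d) = u₂ a b c v - ratio a b c * c := by
  have := h.sum_pos
  have hd : (d : ℝ) = a + b - c := by linarith [h.bal_real]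
  simp only [u₂, ratio]
  push_cast
  rw [hd]
  field_simp
  ring

/-- A red draw adds σ b and a black one subtracts σ c, so the mean increment is σ (b v.1 - c v.2) /
(v.1 + v.2) = σ u₂ / τ. -/
theorem IsLarge.stepMean_u₂ (h : IsLarge a b c d) {v : ℕ × ℕ} (hv : v ≠ 0) :
    stepMean a b c d (u₂ a b c) v = (1 + ratio a b c / mass a b v) * u₂ a b c v := by
  have hS := h.sum_pos
  have hT := cast_add_cast_pos hv
  rw [stepMean, h.u₂_red, h.u₂_black]
  simp only [smul_eq_mul, mass, u₂]
  field_simp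
  ring

/-- The constant for which `u₂² + A * mass` is a supersolution. -/
noncomputable def varConst (a b c : ℕ) : ℝ :=
  ((b : ℝ) ^ 2 + (c : ℝ) ^ 2) * ratio a b c ^ 2 / (2 * ratio a b c - 1)

/-- The function `u₂² + A * mass`. -/
noncomputable def energy (a b c : ℕ) (v : ℕ × ℕ) : ℝ :=
  u₂ a b c v ^ 2 + varConst a b c * mass a b v

theorem IsLarge.varConst_nonneg (h : IsLarge a b c d) : 0 ≤ varConst a b c :=
  div_nonneg (by positivity) (by linarith [h.large])

theorem IsLarge.energy_nonneg (h : IsLarge a b c d) (v : ℕ × ℕ) : 0 ≤ energy a b c v :=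
  add_nonneg (sq_nonneg _) (mul_nonneg h.varConst_nonneg
    (div_nonneg (by positivity) h.sum_pos.le))

/-- The mean of u₂² grows by 2σ u₂²/τ plus at most (b² + c²) σ², and A τ grows by A. The constant A
is chosen so that these additive terms sum exactly to 2σ A = (2σ/τ) A τ, which is possible with A ≥
0 since 2σ > 1. -/
theorem IsLarge.stepMean_energy (h : IsLarge a b c d) {v : ℕ × ℕ} (hv : v ≠ 0) :
    stepMean a b c d (energy a b c) v
      ≤ (1 + 2 * ratio a b c / mass a b v) * energy a b c v := by
  have hS := h.sum_pos
  have hT := cast_add_cast_pos hv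
  have hm := h.mass_pos hv
  set σ := ratio a b c with hσ
  set A := varConst a b c with hA
  have hAeq : ((b : ℝ) ^ 2 + (c : ℝ) ^ 2) * σ ^ 2 + A = 2 * σ * A := by
    have : 2 * σ - 1 ≠ 0 := by linarith [h.large]
    have h2 : A * (2 * σ - 1) = ((b : ℝ) ^ 2 + (c : ℝ) ^ 2) * σ ^ 2 := by
      rw [hA, varConst, div_mul_cancel₀ _ this]
    linarith
  set p := (v.1 : ℝ) / (v.1 + v.2) with hp
  set q := (v.2 : ℝ) / (v.1 + v.2) with hq
  have hpq : p + q = 1 := by rw [hp, hq]; field_simp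
  have hp0 : 0 ≤ p := by positivity
  have hq0 : 0 ≤ q := by positivity
  have hu : p * b - q * c = u₂ a b c v / mass a b v := by
    rw [hp, hq, u₂, mass]; field_simp
  set u := u₂ a b c v
  set τ := mass a b v
  have hrhs : (1 + 2 * σ / τ) * (u ^ 2 + A * τ) = u ^ 2 + A * τ + 2 * σ * u * (u / τ) + 2 * σ * A := by
    field_simp
    ring
  simp only [stepMean, energy, smul_eq_mul, h.mass_red, h.mass_black, h.u₂_red, h.u₂_black]
  rw [← hp, ← hq, hrhs, ← hu, ← hAeq]
  have hq' : q = 1 - p := by linarith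
  have : p * ((u + σ * b) ^ 2 + A * (τ + 1)) + q * ((u - σ * c) ^ 2 + A * (τ + 1))
      = u ^ 2 + A * τ + 2 * σ * u * (p * b - q * c) + (p * b ^ 2 + q * c ^ 2) * σ ^ 2 + A := by
    rw [hq']; ring
  rw [this]
  have h5 : (p * (b : ℝ) ^ 2 + q * (c : ℝ) ^ 2) * σ ^ 2 ≤ ((b : ℝ) ^ 2 + (c : ℝ) ^ 2) * σ ^ 2 := by
    gcongr
    · exact mul_le_of_le_one_left (by positivity) (by linarith)
    · exact mul_le_of_le_one_left (by positivity) (by linarith)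
  linarith

theorem IsLarge.ae_mass (h : IsLarge a b c d) {v : ℕ × ℕ} (hv : v ≠ 0) (n : ℕ) :
    ∀ᵐ U ∂(urnLaw a b c d v.1 v.2), mass a b (U n) = mass a b v + n := by
  filter_upwards [urnLaw_ae_total h.bal (α := v.1) (β := v.2) hv n] with U hU
  exact h.mass_eq hU

theorem IsLarge.integral_u₂ (h : IsLarge a b c d) {v : ℕ × ℕ} (hv : v ≠ 0) (n : ℕ) :
    ∫ U, u₂ a b c (U n) ∂(urnLaw a b c d v.1 v.2)
      = u₂ a b c v * growth (ratio a b c) (mass a b v) n := by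
  induction n with
  | zero =>
    rw [integral_urnLaw h.bal (α := v.1) (β := v.2) hv]
    simp [growth]
  | succ n ih =>
    rw [integral_urnLaw_succ h.bal (α := v.1) (β := v.2) hv, growth_succ, ← mul_assoc, ← ih,
      ← integral_mul_const]
    refine integral_congr_ae ?_
    filter_upwards [h.ae_mass hv n, urnLaw_ae_ne_zero h.bal (α := v.1) (β := v.2) hv n]
      with U hU hU0
    rw [h.stepMean_u₂ hU0, hU, mul_comm]

theorem IsLarge.integral_energy_le (h : IsLarge a b c d) {v : ℕ × ℕ} (hv : v ≠ 0) (n : ℕ) :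
    ∫ U, energy a b c (U n) ∂(urnLaw a b c d v.1 v.2)
      ≤ energy a b c v * growth (2 * ratio a b c) (mass a b v) n := by
  induction n with
  | zero =>
    rw [integral_urnLaw h.bal (α := v.1) (β := v.2) hv]
    simp [growth]
  | succ n ih =>
    have hr := h.ratio_pos
    have hm := h.mass_pos hv
    rw [integral_urnLaw_succ h.bal (α := v.1) (β := v.2) hv, growth_succ, ← mul_assoc]
    refine le_trans ?_ (mul_le_mul_of_nonneg_right ih (by positivity))
    rw [← integral_mul_const]
    refine integral_mono_ae (integrable_urnLaw h.bal (α := v.1) (β := v.2) hv _ n)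
      ((integrable_urnLaw h.bal (α := v.1) (β := v.2) hv (energy a b c) n).mul_const _) ?_
    filter_upwards [h.ae_mass hv n, urnLaw_ae_ne_zero h.bal (α := v.1) (β := v.2) hv n]
      with U hU hU0
    have := h.stepMean_energy hU0
    rw [hU] at this
    rw [mul_comm]
    exact this

theorem IsLarge.integral_u₂_sq_le (h : IsLarge a b c d) {v : ℕ × ℕ} (hv : v ≠ 0) (n : ℕ) :
    ∫ U, u₂ a b c (U n) ^ 2 ∂(urnLaw a b c d v.1 v.2)
      ≤ energy a b c v * growth (2 * ratio a b c) (mass a b v) n := by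
  refine le_trans (integral_mono
    (integrable_urnLaw h.bal (α := v.1) (β := v.2) hv (fun w => u₂ a b c w ^ 2) n)
    (integrable_urnLaw h.bal (α := v.1) (β := v.2) hv (energy a b c) n) fun U => ?_)
    (h.integral_energy_le hv n)
  exact le_add_of_nonneg_right (mul_nonneg h.varConst_nonneg
    (div_nonneg (by positivity) h.sum_pos.le))

end Mean

/-! ### Almost sure convergence by an L²-bounded martingale. -/

section Convergence

variable {a b c d : ℕ}

theorem IsLarge.martingale (h : IsLarge a b c d) {v : ℕ × ℕ} (hv : v ≠ 0) :
    Martingale (fun n (U : ℕ → ℕ × ℕ) => u₂ a b c (U n) / growth (ratio a b c) (mass a b v) n)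
      (Filtration.piLE (X := fun _ => ℕ × ℕ)) (urnLaw a b c d v.1 v.2) := by
  refine martingale_nat (fun n => ?_) (fun n => ?_) fun n => ?_
  · have hm : Measurable[Filtration.piLE (X := fun _ => ℕ × ℕ) n]
        (fun U : ℕ → ℕ × ℕ => U n) := by
      rw [Filtration.piLE_eq_comap_frestrictLe]
      exact (measurable_pi_apply (X := fun _ : Finset.Iic n => ℕ × ℕ) ⟨n, by simp⟩).comp
        (comap_measurable _)
    exact (StronglyMeasurable.of_discrete (f := fun w : ℕ × ℕ =>
      u₂ a b c w / growth (ratio a b c) (mass a b v) n)).comp_measurable hm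
  · exact (integrable_urnLaw h.bal (α := v.1) (β := v.2) hv (u₂ a b c) n).div_const _
  · have h1 := condExp_urnLaw h.bal (α := v.1) (β := v.2) hv
      (fun w => u₂ a b c w / growth (ratio a b c) (mass a b v) (n + 1)) n
    refine EventuallyEq.symm ?_
    filter_upwards [h1, h.ae_mass hv n, urnLaw_ae_ne_zero h.bal (α := v.1) (β := v.2) hv n]
      with U hU hm h0
    rw [hU]
    have h2 := h.stepMean_u₂ h0
    have hr := h.ratio_pos
    have hmp := h.mass_pos hv
    have hg := growth_pos hr hmp n
    rw [hm] at h2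
    have h3 : stepMean a b c d (fun w => u₂ a b c w / growth (ratio a b c) (mass a b v) (n + 1))
        (U n) = stepMean a b c d (u₂ a b c) (U n) / growth (ratio a b c) (mass a b v) (n + 1) := by
      simp only [stepMean, smul_eq_mul]
      ring
    rw [h3, h2, growth_succ]
    have : 1 + ratio a b c / (mass a b v + n) ≠ 0 := by positivity
    field_simp

theorem IsLarge.ae_tendsto (h : IsLarge a b c d) {v : ℕ × ℕ} (hv : v ≠ 0) :
    ∀ᵐ U ∂(urnLaw a b c d v.1 v.2), ∃ w : ℝ, Tendsto (scaled a b c U) atTop (𝓝 w) := by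
  have hr := h.ratio_pos
  have hm := h.mass_pos hv
  set σ := ratio a b c
  set τ := mass a b v
  have hM := h.martingale hv
  have hb : ∀ n, eLpNorm (fun U : ℕ → ℕ × ℕ => u₂ a b c (U n) / growth σ τ n) 1
      (urnLaw a b c d v.1 v.2) ≤ (((1 + energy a b c v) / 2).toNNReal : ℝ≥0∞) := by
    intro n
    have hg := growth_pos hr hm n
    have hg2 := growth_pos (s := 2 * σ) (by positivity) hm n
    rw [eLpNorm_one_eq_lintegral_enorm, ← ofReal_integral_norm_eq_lintegral_enorm
      (hM.integrable n)]
    refine ENNReal.ofReal_le_ofReal ?_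
    have hi : Integrable (fun U : ℕ → ℕ × ℕ => (1 + u₂ a b c (U n) ^ 2 / growth (2 * σ) τ n) / 2)
        (urnLaw a b c d v.1 v.2) :=
      ((integrable_const _).add ((integrable_urnLaw h.bal (α := v.1) (β := v.2) hv
        (fun w => u₂ a b c w ^ 2) n).div_const _)).div_const _
    refine (integral_mono (hM.integrable n).norm hi fun U => ?_).trans ?_
    · have h1 : ‖u₂ a b c (U n) / growth σ τ n‖ ≤ (1 + ‖u₂ a b c (U n) / growth σ τ n‖ ^ 2) / 2 := by
        nlinarith [sq_nonneg (1 - ‖u₂ a b c (U n) / growth σ τ n‖)]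
      refine h1.trans ?_
      rw [Real.norm_eq_abs, sq_abs, div_pow]
      have := div_le_div_of_nonneg_left (sq_nonneg (u₂ a b c (U n))) hg2
        (growth_two_mul_le hr hm n)
      linarith
    · rw [integral_div, integral_add (integrable_const _)
        ((integrable_urnLaw h.bal (α := v.1) (β := v.2) hv
        (fun w => u₂ a b c w ^ 2) n).div_const _), integral_div]
      have h2 := h.integral_u₂_sq_le hv n
      have h3 := div_le_of_le_mul₀ hg2.le (h.energy_nonneg v) h2
      simp only [integral_const, probReal_univ, one_smul]
      linarith
  filter_upwards [hM.submartingale.exists_ae_tendsto_of_bdd hb] with U ⟨w, hw⟩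
  refine ⟨w * gammaRatio σ τ, ?_⟩
  refine (hw.mul (tendsto_growth hr hm)).congr fun n => ?_
  have hg := growth_pos hr hm n
  change u₂ a b c (U n) / growth σ τ n * (growth σ τ n / (n : ℝ) ^ σ) =
    u₂ a b c (U n) / (n : ℝ) ^ σ
  field_simp

end Convergence

/-! ### Passing moments to the limit. -/

/-- A form of Fatou's lemma for nonnegative real functions. -/
theorem integral_le_of_tendsto_ae {Ω : Type*} [MeasurableSpace Ω] {μ : Measure Ω}
    {f : ℕ → Ω → ℝ} {g : Ω → ℝ} {L : ℕ → ℝ} {l : ℝ} (hf : ∀ n, Integrable (f n) μ)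
    (h0 : ∀ n ω, 0 ≤ f n ω) (hfg : ∀ᵐ ω ∂μ, Tendsto (fun n => f n ω) atTop (𝓝 (g ω)))
    (hL : ∀ n, ∫ ω, f n ω ∂μ ≤ L n) (hl : Tendsto L atTop (𝓝 l)) :
    Integrable g μ ∧ ∫ ω, g ω ∂μ ≤ l := by
  have hgm : AEStronglyMeasurable g μ :=
    aestronglyMeasurable_of_tendsto_ae atTop (fun n => (hf n).aestronglyMeasurable) hfg
  have hg0 : ∀ᵐ ω ∂μ, 0 ≤ g ω := by
    filter_upwards [hfg] with ω hω using ge_of_tendsto' hω fun n => h0 n ω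
  have hl0 : 0 ≤ l := ge_of_tendsto' hl fun n => (integral_nonneg (h0 n)).trans (hL n)
  have key : ∫⁻ ω, ENNReal.ofReal (g ω) ∂μ ≤ ENNReal.ofReal l := by
    have h1 : ∫⁻ ω, ENNReal.ofReal (g ω) ∂μ
        = ∫⁻ ω, liminf (fun n => ENNReal.ofReal (f n ω)) atTop ∂μ := by
      refine lintegral_congr_ae ?_
      filter_upwards [hfg] with ω hω
      exact (ENNReal.tendsto_ofReal hω).liminf_eq.symm
    have h2 : liminf (fun n => ENNReal.ofReal (L n)) atTop = ENNReal.ofReal l :=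
      (ENNReal.tendsto_ofReal hl).liminf_eq
    rw [h1, ← h2]
    refine (lintegral_liminf_le' fun n => (hf n).aemeasurable.ennreal_ofReal).trans ?_
    refine liminf_le_liminf (.of_forall fun n => ?_)
    rw [← ofReal_integral_eq_lintegral_ofReal (hf n) (.of_forall (h0 n))]
    exact ENNReal.ofReal_le_ofReal (hL n)
  have hint : Integrable g μ := by
    refine ⟨hgm, ?_⟩
    rw [hasFiniteIntegral_iff_ofReal hg0]
    exact key.trans_lt ENNReal.ofReal_lt_top
  refine ⟨hint, ?_⟩
  rwa [← ofReal_integral_eq_lintegral_ofReal hint hg0, ENNReal.ofReal_le_ofReal_iff hl0] at key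

/-- The law `μ` has mean `r` and its second moment is at most `q`. -/
structure HasMoments (μ : Measure ℝ) (r q : ℝ) : Prop where
  integrable_sq : Integrable (fun x => x ^ 2) μ
  mean : ∫ x, x ∂μ = r
  sq_le : ∫ x, x ^ 2 ∂μ ≤ q

theorem HasMoments.integrable {μ : Measure ℝ} [IsProbabilityMeasure μ] {r q : ℝ}
    (h : HasMoments μ r q) : Integrable (fun x => x) μ := by
  refine ((integrable_const (1 : ℝ)).add h.integrable_sq).mono
    measurable_id.aestronglyMeasurable (.of_forall fun x => ?_)
  simp only [Pi.add_apply, Real.norm_eq_abs]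
  rw [abs_of_nonneg (a := 1 + x ^ 2) (by positivity)]
  nlinarith [sq_abs x, sq_nonneg (|x| - 1), abs_nonneg x]

/-- Fatou's lemma yields only upper bounds, but having them for all shifts e recovers the exact
mean: after cancellation of e² the bound reads constant ≤ e · slope, which for all real e forces the
slope, twice the error in the mean, to vanish. -/
theorem HasMoments.of_integral_sub_sq_le {μ : Measure ℝ} [IsProbabilityMeasure μ] {r q : ℝ}
    (h : ∀ e : ℝ, Integrable (fun x => (x - e) ^ 2) μ ∧
      ∫ x, (x - e) ^ 2 ∂μ ≤ q - 2 * e * r + e ^ 2) : HasMoments μ r q := by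
  have h2 : Integrable (fun x => x ^ 2) μ := by simpa using (h 0).1
  have h1 : Integrable (fun x : ℝ => x) μ := by
    have := (h2.sub (h 1).1).add (integrable_const (1 : ℝ))
    refine (this.div_const 2).congr (.of_forall fun x => ?_)
    simp only [Pi.add_apply, Pi.sub_apply]
    ring
  have key : ∀ e : ℝ, ∫ x, x ^ 2 ∂μ - q ≤ 2 * e * (∫ x, x ∂μ - r) := by
    intro e
    have h3 : ∫ x, (x - e) ^ 2 ∂μ = ∫ x, x ^ 2 ∂μ - 2 * e * ∫ x, x ∂μ + e ^ 2 := by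
      have : ∀ x : ℝ, (x - e) ^ 2 = x ^ 2 - 2 * e * x + e ^ 2 := fun x => by ring
      simp only [this]
      rw [integral_add (by exact h2.sub (h1.const_mul (2 * e))) (integrable_const _),
        integral_sub h2 (h1.const_mul _), integral_const_mul]
      simp
    have h4 := (h e).2
    rw [h3] at h4
    linarith
  refine ⟨h2, ?_, by simpa using key 0⟩
  by_contra hne
  have hne' : ∫ x, x ∂μ - r ≠ 0 := sub_ne_zero.2 hne
  -- This shift makes the right side of `key` one less than its left side.
  have := key ((∫ x, x ^ 2 ∂μ - q - 1) / (2 * (∫ x, x ∂μ - r)))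
  have e : 2 * ((∫ x, x ^ 2 ∂μ - q - 1) / (2 * (∫ x, x ∂μ - r))) * (∫ x, x ∂μ - r)
      = ∫ x, x ^ 2 ∂μ - q - 1 := by field_simp
  linarith

/-! ### The limit law: its moments and its first-step equation. -/

section LimitLaw

variable {a b c d : ℕ}

theorem IsLarge.ae_tendsto_limUnder (h : IsLarge a b c d) {v : ℕ × ℕ} (hv : v ≠ 0) :
    ∀ᵐ U ∂(urnLaw a b c d v.1 v.2),
      Tendsto (scaled a b c U) atTop (𝓝 (limUnder atTop (scaled a b c U))) := by
  filter_upwards [h.ae_tendsto hv] with U hU using tendsto_nhds_limUnder hU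

theorem measurable_scaled (a b c n : ℕ) :
    Measurable (fun U : ℕ → ℕ × ℕ => scaled a b c U n) :=
  (Measurable.of_discrete (f := fun w : ℕ × ℕ => u₂ a b c w / (n : ℝ) ^ ratio a b c)).comp
    (measurable_pi_apply n)

theorem IsLarge.aemeasurable_limUnder (h : IsLarge a b c d) {v : ℕ × ℕ} (hv : v ≠ 0) :
    AEMeasurable (fun U => limUnder atTop (scaled a b c U)) (urnLaw a b c d v.1 v.2) :=
  aemeasurable_of_tendsto_metrizable_ae atTop (fun n => (measurable_scaled a b c n).aemeasurable)
    (h.ae_tendsto_limUnder hv)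

theorem IsLarge.isProbabilityMeasure_limitLaw (h : IsLarge a b c d) {v : ℕ × ℕ} (hv : v ≠ 0) :
    IsProbabilityMeasure (limitLaw a b c d v.1 v.2) :=
  Measure.isProbabilityMeasure_map (h.aemeasurable_limUnder hv)

/-- Fatou's lemma is applied to the shifted squares (n^(-σ) u₂(U n) - e)², whose expectations
involve the exact first moment and the energy bound on the second. -/
theorem IsLarge.hasMoments (h : IsLarge a b c d) {v : ℕ × ℕ} (hv : v ≠ 0) :
    HasMoments (limitLaw a b c d v.1 v.2) (u₂ a b c v * gammaRatio (ratio a b c) (mass a b v))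
      (energy a b c v * gammaRatio (2 * ratio a b c) (mass a b v)) := by
  have := h.isProbabilityMeasure_limitLaw hv
  have hr := h.ratio_pos
  have hm := h.mass_pos hv
  refine .of_integral_sub_sq_le fun e => ?_
  have hmeas : AEStronglyMeasurable (fun x : ℝ => (x - e) ^ 2) (limitLaw a b c d v.1 v.2) := by
    fun_prop
  rw [limitLaw, integrable_map_measure hmeas (h.aemeasurable_limUnder hv),
    integral_map (h.aemeasurable_limUnder hv) hmeas]
  set σ := ratio a b c with hσ
  set τ := mass a b v
  have hint : ∀ f : ℕ × ℕ → ℝ, ∀ n, Integrable (fun U => f (U n)) (urnLaw a b c d v.1 v.2) :=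
    integrable_urnLaw h.bal (α := v.1) (β := v.2) hv
  refine integral_le_of_tendsto_ae
    (f := fun n U => (scaled a b c U n - e) ^ 2)
    (L := fun n => energy a b c v * (growth (2 * σ) τ n / (n : ℝ) ^ (2 * σ))
      - 2 * e * (u₂ a b c v * (growth σ τ n / (n : ℝ) ^ σ)) + e ^ 2)
    (fun n => hint (fun w => (u₂ a b c w / (n : ℝ) ^ σ - e) ^ 2) n)
    (fun n U => sq_nonneg _) ?_ (fun n => ?_) ?_
  · filter_upwards [h.ae_tendsto_limUnder hv] with U hU
    exact (hU.sub_const e).pow 2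
  · have h1 : ∀ U : ℕ → ℕ × ℕ, (scaled a b c U n - e) ^ 2 =
        u₂ a b c (U n) ^ 2 / (n : ℝ) ^ (2 * σ) - 2 * e / (n : ℝ) ^ σ * u₂ a b c (U n) + e ^ 2 := by
      intro U
      rw [scaled, mul_comm 2 σ, Real.rpow_mul (by positivity), Real.rpow_two]
      ring
    simp only [h1]
    have i1 := (hint (fun w => u₂ a b c w ^ 2) n).div_const ((n : ℝ) ^ (2 * σ))
    have i2 := (hint (u₂ a b c) n).const_mul (2 * e / (n : ℝ) ^ σ)
    rw [integral_add (by exact i1.sub i2) (integrable_const _), integral_sub i1 i2, integral_div, integral_const_mul, h.integral_u₂ hv]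
    have h2 := div_le_div_of_nonneg_right (h.integral_u₂_sq_le hv n)
      (Real.rpow_nonneg (Nat.cast_nonneg n) (2 * σ))
    rw [mul_div_assoc] at h2
    simp only [integral_const, probReal_univ, one_smul]
    have h3 : 2 * e / (n : ℝ) ^ σ * (u₂ a b c v * growth σ τ n)
      = 2 * e * (u₂ a b c v * (growth σ τ n / (n : ℝ) ^ σ)) := by ring
    rw [← hσ, h3]
    linarith
  · exact (((tendsto_growth (by positivity) hm).const_mul _).sub
      (((tendsto_growth hr hm).const_mul _).const_mul _)).add_const _

/-- The exponential whose expectation is the characteristic function of a rescaled projection. -/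
noncomputable def phase (a b c : ℕ) (t κ : ℝ) (w : ℕ × ℕ) : ℂ :=
  Complex.exp (t * ↑(u₂ a b c w * κ) * Complex.I)

/-- The free normalization κ allows both n^(-σ) and (n + 1)^(-σ) at time n, as the first-step
equation requires. -/
theorem IsLarge.tendsto_charFun (h : IsLarge a b c d) {v : ℕ × ℕ} (hv : v ≠ 0) (t : ℝ)
    {κ : ℕ → ℝ} (hκ : Tendsto (fun n : ℕ => κ n * (n : ℝ) ^ ratio a b c) atTop (𝓝 1)) :
    Tendsto (fun n => ∫ U, phase a b c t (κ n) (U n)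
      ∂(urnLaw a b c d v.1 v.2)) atTop (𝓝 (charFun (limitLaw a b c d v.1 v.2) t)) := by
  have hc : Continuous fun x : ℝ => Complex.exp (t * x * Complex.I) := by fun_prop
  rw [charFun_apply_real, limitLaw, integral_map (h.aemeasurable_limUnder hv)
    hc.aestronglyMeasurable]
  refine tendsto_integral_of_dominated_convergence (fun _ => 1) (fun n => ?_)
    (integrable_const _) (fun n => .of_forall fun U => ?_) ?_
  · exact (integrable_urnLaw h.bal (α := v.1) (β := v.2) hv
      (phase a b c t (κ n)) n).aestronglyMeasurable
  · rw [phase, ← Complex.ofReal_mul, Complex.norm_exp_ofReal_mul_I]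
  · filter_upwards [h.ae_tendsto_limUnder hv] with U hU
    have h1 : Tendsto (fun n => u₂ a b c (U n) * κ n) atTop
        (𝓝 (limUnder atTop (scaled a b c U))) := by
      have := hU.mul hκ
      rw [mul_one] at this
      refine this.congr' ?_
      filter_upwards [eventually_gt_atTop 0] with n hn
      have : (n : ℝ) ^ ratio a b c ≠ 0 := by positivity
      rw [scaled]
      field_simp
    exact (hc.tendsto _).comp h1

theorem IsLarge.charFun_eq_stepMean (h : IsLarge a b c d) {v : ℕ × ℕ} (hv : v ≠ 0) (t : ℝ) :
    charFun (limitLaw a b c d v.1 v.2) t =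
      stepMean a b c d (fun w => charFun (limitLaw a b c d w.1 w.2) t) v := by
  have hr := h.ratio_pos
  have hκ : Tendsto (fun n : ℕ => ((n : ℝ) ^ ratio a b c)⁻¹ * (n : ℝ) ^ ratio a b c) atTop
      (𝓝 1) := by
    refine tendsto_const_nhds.congr' ?_
    filter_upwards [eventually_gt_atTop 0] with n hn
    have : (n : ℝ) ^ ratio a b c ≠ 0 := by positivity
    field_simp
  have hκ' : Tendsto (fun n : ℕ => (((n + 1 : ℕ) : ℝ) ^ ratio a b c)⁻¹ * (n : ℝ) ^ ratio a b c)
      atTop (𝓝 1) := by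
    have h1 : Tendsto (fun n : ℕ => ((n : ℝ) / (n + 1)) ^ ratio a b c) atTop
        (𝓝 (1 ^ ratio a b c)) :=
      (tendsto_natCast_div_add_atTop (1 : ℝ)).rpow_const (Or.inl one_ne_zero)
    rw [Real.one_rpow] at h1
    refine h1.congr fun n => ?_
    rw [Real.div_rpow (by positivity) (by positivity)]
    push_cast
    rw [div_eq_inv_mul]
  -- The urn from v is observed at time n + 1 and those from its two successors at time n, all
  -- rescaled by (n + 1)^(-σ).
  have h1 := (h.tendsto_charFun hv t hκ).comp (tendsto_add_atTop_nat 1)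
  have h2 := ((h.tendsto_charFun (h.red_ne v) t hκ').const_smul ((v.1 : ℝ) / (v.1 + v.2))).add
    ((h.tendsto_charFun (h.black_ne v) t hκ').const_smul ((v.2 : ℝ) / (v.1 + v.2)))
  refine tendsto_nhds_unique h1 (h2.congr fun n => ?_)
  exact (integral_urnLaw_succ' h.bal h.a_ne h.d_ne hv n
    (phase a b c t (((n + 1 : ℕ) : ℝ) ^ ratio a b c)⁻¹)).symm

end LimitLaw

/-- A quantitative comparison of a characteristic function with the one of a Dirac mass. -/
theorem norm_integral_exp_sub_le {Ω : Type*} [MeasurableSpace Ω] {μ : Measure Ω}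
    [IsProbabilityMeasure μ] {Y : Ω → ℝ} (hY : AEMeasurable Y μ) {r V ε t : ℝ} (hε : 0 < ε)
    (hi : Integrable (fun ω => (Y ω - r) ^ 2) μ) (hV : ∫ ω, (Y ω - r) ^ 2 ∂μ ≤ V) :
    ‖∫ ω, Complex.exp (t * Y ω * Complex.I) ∂μ - Complex.exp (t * r * Complex.I)‖
      ≤ |t| * (ε + V / ε) := by
  have hexp : Integrable (fun ω => Complex.exp (t * Y ω * Complex.I)) μ := by
    refine Integrable.of_bound (C := 1) ?_ (.of_forall fun ω => ?_)
    · have : AEMeasurable (fun ω => Complex.exp (t * Y ω * Complex.I)) μ := by fun_prop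
      exact this.aestronglyMeasurable
    · rw [← Complex.ofReal_mul, Complex.norm_exp_ofReal_mul_I]
  have h1 : ∫ ω, Complex.exp (t * Y ω * Complex.I) ∂μ - Complex.exp (t * r * Complex.I)
      = ∫ ω, (Complex.exp (t * Y ω * Complex.I) - Complex.exp (t * r * Complex.I)) ∂μ := by
    rw [integral_sub hexp (integrable_const _)]
    simp
  rw [h1]
  refine (norm_integral_le_of_norm_le (g := fun ω => |t| * (ε + (Y ω - r) ^ 2 / ε))
    (((integrable_const _).add (hi.div_const _)).const_mul _) (.of_forall fun ω => ?_)).trans ?_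
  · have h2 : Complex.exp (t * Y ω * Complex.I) - Complex.exp (t * r * Complex.I)
        = Complex.exp (↑(t * r) * Complex.I) *
          (Complex.exp (Complex.I * ↑(t * (Y ω - r))) - 1) := by
      rw [mul_sub, mul_one, ← Complex.exp_add]
      congr 1
      · congr 1
        push_cast
        ring
      · push_cast; rfl
    rw [h2, norm_mul, Complex.norm_exp_ofReal_mul_I, one_mul]
    refine (Real.norm_exp_I_mul_ofReal_sub_one_le).trans ?_
    rw [Real.norm_eq_abs, abs_mul]
    refine mul_le_mul_of_nonneg_left ?_ (abs_nonneg _)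
    -- It remains to see |y| ≤ ε + y²/ε, the splitting that brings in the variance.
    rw [← sub_nonneg]
    have h3 : ε + (Y ω - r) ^ 2 / ε - |Y ω - r|
        = ((ε - |Y ω - r|) ^ 2 + ε * |Y ω - r|) / ε := by
      rw [← sq_abs (Y ω - r)]
      field_simp
      ring
    rw [h3]
    positivity
  · rw [integral_const_mul, integral_add (integrable_const _) (hi.div_const _), integral_div]
    simp only [integral_const, probReal_univ, one_smul]
    gcongr

/-! ### Beta distributions: moments and splitting of the density. -/

section Beta

theorem betaPDFReal_nonneg {p q : ℝ} (hp : 0 < p) (hq : 0 < q) (x : ℝ) :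
    0 ≤ betaPDFReal p q x := by
  by_cases h : 0 < x ∧ x < 1
  · exact (betaPDFReal_pos h.1 h.2 hp hq).le
  · rw [betaPDFReal, if_neg h]

theorem betaPDFReal_mul {p q s u : ℝ} (hp : 0 < p) (hq : 0 < q) (hs : 0 ≤ s) (hu : 0 ≤ u) (x : ℝ) :
    betaPDFReal p q x * (x ^ s * (1 - x) ^ u)
      = beta (p + s) (q + u) / beta p q * betaPDFReal (p + s) (q + u) x := by
  by_cases h : 0 < x ∧ x < 1
  · have h1 := beta_pos hp hq
    have h2 := beta_pos (add_pos_of_pos_of_nonneg hp hs) (add_pos_of_pos_of_nonneg hq hu)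
    have h3 : 0 < 1 - x := by linarith [h.2]
    rw [betaPDFReal, betaPDFReal, if_pos h, if_pos h,
      show p + s - 1 = p - 1 + s by ring, show q + u - 1 = q - 1 + u by ring,
      Real.rpow_add h.1, Real.rpow_add h3]
    field_simp
  · rw [betaPDFReal, betaPDFReal, if_neg h, if_neg h]
    simp

/-- Multiply the density by x + (1 - x) = 1; each summand is a beta density with one parameter
raised by 1. The weights are the chances that a draw hits a part of mass p or q. -/
theorem betaPDFReal_split {p q : ℝ} (hp : 0 < p) (hq : 0 < q) (x : ℝ) :
    betaPDFReal p q x = p / (p + q) * betaPDFReal (p + 1) q x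
      + q / (p + q) * betaPDFReal p (q + 1) x := by
  have h1 := betaPDFReal_mul hp hq zero_le_one le_rfl x
  have h2 := betaPDFReal_mul hp hq le_rfl zero_le_one x
  simp only [Real.rpow_one, Real.rpow_zero, mul_one, one_mul, add_zero] at h1 h2
  have hG := Real.Gamma_pos_of_pos hp
  have hG' := Real.Gamma_pos_of_pos hq
  have hG2 := Real.Gamma_pos_of_pos (add_pos hp hq)
  have b1 : beta (p + 1) q / beta p q = p / (p + q) := by
    rw [beta, beta, show p + 1 + q = p + q + 1 by ring, Real.Gamma_add_one hp.ne',
      Real.Gamma_add_one (add_pos hp hq).ne']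
    field_simp
  have b2 : beta p (q + 1) / beta p q = q / (p + q) := by
    rw [beta, beta, show p + (q + 1) = p + q + 1 by ring, Real.Gamma_add_one hq.ne',
      Real.Gamma_add_one (add_pos hp hq).ne']
    field_simp
  rw [← b1, ← b2, ← h1, ← h2]
  ring

theorem betaPDF_lt_top (p q x : ℝ) : betaPDF p q x < ∞ := ENNReal.ofReal_lt_top

theorem measurable_betaPDF (p q : ℝ) : Measurable (betaPDF p q) :=
  (measurable_betaPDFReal p q).ennreal_ofReal

theorem integral_betaMeasure {E : Type*} [NormedAddCommGroup E] [NormedSpace ℝ E] {p q : ℝ}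
    (hp : 0 < p) (hq : 0 < q) (f : ℝ → E) :
    ∫ x, f x ∂(betaMeasure p q) = ∫ x, betaPDFReal p q x • f x := by
  rw [betaMeasure, integral_withDensity_eq_integral_toReal_smul (measurable_betaPDF p q)
    (.of_forall (betaPDF_lt_top p q))]
  simp only [betaPDF, ENNReal.toReal_ofReal (betaPDFReal_nonneg hp hq _)]

theorem integrable_betaMeasure_iff {E : Type*} [NormedAddCommGroup E] [NormedSpace ℝ E] {p q : ℝ}
    (hp : 0 < p) (hq : 0 < q) {f : ℝ → E} :
    Integrable f (betaMeasure p q) ↔ Integrable (fun x => betaPDFReal p q x • f x) := by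
  rw [betaMeasure, integrable_withDensity_iff_integrable_smul' (measurable_betaPDF p q)
    (.of_forall (betaPDF_lt_top p q))]
  simp only [betaPDF, ENNReal.toReal_ofReal (betaPDFReal_nonneg hp hq _)]

theorem integrable_betaPDFReal {p q : ℝ} (hp : 0 < p) (hq : 0 < q) :
    Integrable (betaPDFReal p q) := by
  have := isProbabilityMeasureBeta hp hq
  simpa using (integrable_betaMeasure_iff hp hq (f := fun _ => (1 : ℝ))).1 (integrable_const _)

theorem integral_betaPDFReal {p q : ℝ} (hp : 0 < p) (hq : 0 < q) :
    ∫ x, betaPDFReal p q x = 1 := by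
  have := isProbabilityMeasureBeta hp hq
  simpa using (integral_betaMeasure hp hq (fun _ => (1 : ℝ))).symm

theorem integrable_beta_moment {p q s u : ℝ} (hp : 0 < p) (hq : 0 < q) (hs : 0 ≤ s)
    (hu : 0 ≤ u) : Integrable (fun x => x ^ s * (1 - x) ^ u) (betaMeasure p q) := by
  rw [integrable_betaMeasure_iff hp hq]
  simp only [smul_eq_mul, betaPDFReal_mul hp hq hs hu]
  exact (integrable_betaPDFReal (by positivity) (by positivity)).const_mul _

theorem integral_beta_moment {p q s u : ℝ} (hp : 0 < p) (hq : 0 < q) (hs : 0 ≤ s) (hu : 0 ≤ u) :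
    ∫ x, x ^ s * (1 - x) ^ u ∂(betaMeasure p q) = beta (p + s) (q + u) / beta p q := by
  rw [integral_betaMeasure hp hq]
  simp only [smul_eq_mul, betaPDFReal_mul hp hq hs hu]
  rw [integral_const_mul, integral_betaPDFReal (by positivity) (by positivity), mul_one]

theorem integral_betaMeasure_split {E : Type*} [NormedAddCommGroup E] [NormedSpace ℝ E] {p q : ℝ}
    (hp : 0 < p) (hq : 0 < q) {f : ℝ → E} (h1 : Integrable f (betaMeasure (p + 1) q))
    (h2 : Integrable f (betaMeasure p (q + 1))) :
    ∫ x, f x ∂(betaMeasure p q) = (p / (p + q)) • ∫ x, f x ∂(betaMeasure (p + 1) q)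
      + (q / (p + q)) • ∫ x, f x ∂(betaMeasure p (q + 1)) := by
  rw [integrable_betaMeasure_iff (by positivity) (by positivity)] at h1 h2
  rw [integral_betaMeasure hp hq, integral_betaMeasure (by positivity) hq,
    integral_betaMeasure hp (by positivity), ← integral_smul, ← integral_smul,
    ← integral_add (by exact h1.smul (p / (p + q))) (by exact h2.smul (q / (p + q)))]
  congr with x
  rw [betaPDFReal_split hp hq, add_smul, mul_smul, mul_smul]

theorem betaMeasure_ae_mem {p q : ℝ} :
    ∀ᵐ x ∂(betaMeasure p q), x ∈ Set.Ioo (0 : ℝ) 1 := by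
  rw [betaMeasure, ae_withDensity_iff (measurable_betaPDF p q)]
  refine .of_forall fun x hx => ?_
  by_contra h
  apply hx
  rw [betaPDF_eq, if_neg (by exact h), ENNReal.ofReal_zero]

end Beta

/-! ### Gamma quotients and moments of independent combinations. -/

theorem gammaRatio_add_nat_mul_growth {s τ : ℝ} (hs : 0 < s) (hτ : 0 < τ) (n : ℕ) :
    gammaRatio s (τ + n) * growth s τ n = gammaRatio s τ := by
  induction n with
  | zero => simp [growth]
  | succ n ih =>
    have h1 : 0 < τ + n := by positivity
    have h2 : 0 < τ + n + s := by positivity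
    have g1 := Real.Gamma_pos_of_pos h1
    have g2 := Real.Gamma_pos_of_pos h2
    rw [← ih, growth_succ, gammaRatio, gammaRatio]
    push_cast
    rw [← add_assoc, show τ + n + 1 + s = τ + n + s + 1 by ring, Real.Gamma_add_one h1.ne',
      Real.Gamma_add_one h2.ne']
    field_simp

/-- The product is of order n^(1 - s), as `gammaRatio` at τ + n is its value at τ divided by
`growth`. -/
theorem tendsto_mul_gammaRatio {s τ : ℝ} (hs : 1 < s) (hτ : 0 < τ) :
    Tendsto (fun n : ℕ => (τ + n) * gammaRatio s (τ + n)) atTop (𝓝 0) := by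
  have hs0 : 0 < s := by linarith
  have h1 : Tendsto (fun n : ℕ => (τ * (n : ℝ) ^ (-s) + (n : ℝ) ^ (-(s - 1)))) atTop
      (𝓝 (τ * 0 + 0)) :=
    (((tendsto_rpow_neg_atTop hs0).comp tendsto_natCast_atTop_atTop).const_mul τ).add
      ((tendsto_rpow_neg_atTop (by linarith)).comp tendsto_natCast_atTop_atTop)
  have h2 := ((tendsto_growth hs0 hτ).inv₀ (gammaRatio_pos hs0 hτ).ne').const_mul (gammaRatio s τ)
  have h3 := h1.mul h2
  simp only [mul_zero, add_zero, zero_mul] at h3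
  refine h3.congr' ?_
  filter_upwards [eventually_gt_atTop 0] with n hn
  have hn' : (0 : ℝ) < n := by exact_mod_cast hn
  have hg := growth_pos hs0 hτ n
  have hp : (n : ℝ) ^ s ≠ 0 := by positivity
  rw [← gammaRatio_add_nat_mul_growth hs0 hτ n, show -(s - 1) = -s + 1 by ring,
    Real.rpow_add hn', Real.rpow_neg hn'.le, Real.rpow_one]
  field_simp

/-- This beta moment replaces the factor `gammaRatio s p` of one part by that of the whole mass p +
q, so means and second moments of the parts recombine. -/
theorem beta_left_div_beta {p q s : ℝ} (hp : 0 < p) (hq : 0 < q) (hs : 0 < s) :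
    beta (p + s) (q + 0) / beta p q = gammaRatio s (p + q) / gammaRatio s p := by
  have g1 := Real.Gamma_pos_of_pos hp
  have g2 := Real.Gamma_pos_of_pos hq
  have g3 := Real.Gamma_pos_of_pos (add_pos hp hs)
  have g4 := Real.Gamma_pos_of_pos (add_pos hp hq)
  have g5 := Real.Gamma_pos_of_pos (add_pos (add_pos hp hq) hs)
  rw [beta, beta, gammaRatio, gammaRatio, add_zero, show p + s + q = p + q + s by ring]
  field_simp

theorem beta_right_div_beta {p q s : ℝ} (hp : 0 < p) (hq : 0 < q) (hs : 0 < s) :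
    beta (p + 0) (q + s) / beta p q = gammaRatio s (p + q) / gammaRatio s q := by
  have g1 := Real.Gamma_pos_of_pos hp
  have g2 := Real.Gamma_pos_of_pos hq
  have g3 := Real.Gamma_pos_of_pos (add_pos hq hs)
  have g4 := Real.Gamma_pos_of_pos (add_pos hp hq)
  have g5 := Real.Gamma_pos_of_pos (add_pos (add_pos hp hq) hs)
  rw [beta, beta, gammaRatio, gammaRatio, add_zero, show p + (q + s) = p + q + s by ring]
  field_simp

theorem beta_both_div_beta {p q s : ℝ} (hp : 0 < p) (hq : 0 < q) (hs : 0 < s) :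
    beta (p + s) (q + s) / beta p q =
      gammaRatio (2 * s) (p + q) / (gammaRatio s p * gammaRatio s q) := by
  have g1 := Real.Gamma_pos_of_pos hp
  have g2 := Real.Gamma_pos_of_pos hq
  have g3 := Real.Gamma_pos_of_pos (add_pos hq hs)
  have g6 := Real.Gamma_pos_of_pos (add_pos hp hs)
  have g4 := Real.Gamma_pos_of_pos (add_pos hp hq)
  have g5 : 0 < Real.Gamma (p + q + 2 * s) := Real.Gamma_pos_of_pos (by positivity)
  rw [beta, beta, gammaRatio, gammaRatio, gammaRatio,
    show p + s + (q + s) = p + q + 2 * s by ring]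
  field_simp

theorem HasMoments.integral_combination_le {μ ν : Measure ℝ} [IsProbabilityMeasure μ]
    [IsProbabilityMeasure ν] {r q r' q' : ℝ} (hμ : HasMoments μ r q) (hν : HasMoments ν r' q')
    (x y e : ℝ) :
    Integrable (fun z : ℝ × ℝ => (x * z.1 + y * z.2 - e) ^ 2) (μ.prod ν) ∧
      ∫ z, (x * z.1 + y * z.2 - e) ^ 2 ∂(μ.prod ν)
        ≤ x ^ 2 * q + y ^ 2 * q' + 2 * x * y * (r * r') - 2 * e * (x * r + y * r') + e ^ 2 := by
  have i1 : Integrable (fun z : ℝ × ℝ => z.1 ^ 2) (μ.prod ν) := hμ.integrable_sq.comp_fst ν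
  have i2 : Integrable (fun z : ℝ × ℝ => z.2 ^ 2) (μ.prod ν) := hν.integrable_sq.comp_snd μ
  have i3 : Integrable (fun z : ℝ × ℝ => z.1) (μ.prod ν) := hμ.integrable.comp_fst ν
  have i4 : Integrable (fun z : ℝ × ℝ => z.2) (μ.prod ν) := hν.integrable.comp_snd μ
  have i5 : Integrable (fun z : ℝ × ℝ => z.1 * z.2) (μ.prod ν) := hμ.integrable.mul_prod hν.integrable
  have j1 : Integrable (fun z : ℝ × ℝ => x ^ 2 * z.1 ^ 2 + y ^ 2 * z.2 ^ 2) (μ.prod ν) :=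
    (i1.const_mul _).add (i2.const_mul _)
  have j2 : Integrable (fun z : ℝ × ℝ => x ^ 2 * z.1 ^ 2 + y ^ 2 * z.2 ^ 2
      + 2 * x * y * (z.1 * z.2)) (μ.prod ν) := j1.add (i5.const_mul _)
  have j3 : Integrable (fun z : ℝ × ℝ => 2 * e * x * z.1 + 2 * e * y * z.2) (μ.prod ν) :=
    (i3.const_mul _).add (i4.const_mul _)
  have j4 : Integrable (fun z : ℝ × ℝ => x ^ 2 * z.1 ^ 2 + y ^ 2 * z.2 ^ 2
      + 2 * x * y * (z.1 * z.2) - (2 * e * x * z.1 + 2 * e * y * z.2)) (μ.prod ν) := j2.sub j3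
  have hexp : ∀ z : ℝ × ℝ, (x * z.1 + y * z.2 - e) ^ 2 = x ^ 2 * z.1 ^ 2 + y ^ 2 * z.2 ^ 2
      + 2 * x * y * (z.1 * z.2) - (2 * e * x * z.1 + 2 * e * y * z.2) + e ^ 2 := fun z => by ring
  simp only [hexp]
  refine ⟨j4.add (integrable_const _), ?_⟩
  rw [integral_add j4 (integrable_const _), integral_sub j2 j3,
    integral_add j1 (i5.const_mul _), integral_add (i1.const_mul _) (i2.const_mul _),
    integral_add (i3.const_mul _) (i4.const_mul _)]
  simp only [integral_const_mul, integral_const, probReal_univ, one_smul]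
  have k1 : ∫ z, z.1 ^ 2 ∂(μ.prod ν) = ∫ y, y ^ 2 ∂μ := by
    simpa using integral_fun_fst (μ := μ) (ν := ν) (fun y : ℝ => y ^ 2)
  have k2 : ∫ z, z.2 ^ 2 ∂(μ.prod ν) = ∫ y, y ^ 2 ∂ν := by
    simpa using integral_fun_snd (μ := μ) (ν := ν) (fun y : ℝ => y ^ 2)
  have k3 : ∫ z, z.1 ∂(μ.prod ν) = r := by
    simpa [hμ.mean] using integral_fun_fst (μ := μ) (ν := ν) (fun y : ℝ => y)
  have k4 : ∫ z, z.2 ∂(μ.prod ν) = r' := by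
    simpa [hν.mean] using integral_fun_snd (μ := μ) (ν := ν) (fun y : ℝ => y)
  have k5 : ∫ z, z.1 * z.2 ∂(μ.prod ν) = r * r' := by
    rw [integral_prod_mul (fun y : ℝ => y) (fun y : ℝ => y), hμ.mean, hν.mean]
  rw [k1, k2, k3, k4, k5]
  have := mul_le_mul_of_nonneg_left hμ.sq_le (sq_nonneg x)
  have := mul_le_mul_of_nonneg_left hν.sq_le (sq_nonneg y)
  linarith

/-! ### Concentration of both sides of the splitting identity for large mass. -/

section Split

variable {a b c d : ℕ}

/-- The characteristic function of `B ^ σ * W_v + (1 - B) ^ σ * W_w`, where `B`, `W_v`, `W_w` are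
independent and `B` has the beta distribution with parameters the masses of `v` and `w`. -/
noncomputable def splitFun (a b c d : ℕ) (v w : ℕ × ℕ) (t : ℝ) : ℂ :=
  ∫ x, charFun (limitLaw a b c d v.1 v.2) (t * x ^ ratio a b c) *
    charFun (limitLaw a b c d w.1 w.2) (t * (1 - x) ^ ratio a b c)
    ∂(betaMeasure (mass a b v) (mass a b w))

/-- A bound of the variances of the laws with total mass `τ`. -/
noncomputable def varBound (a b c : ℕ) (τ : ℝ) : ℝ :=
  varConst a b c * (τ * gammaRatio (2 * ratio a b c) τ)

theorem IsLarge.tendsto_varBound (h : IsLarge a b c d) {τ : ℝ} (hτ : 0 < τ) :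
    Tendsto (fun n : ℕ => varBound a b c (τ + n)) atTop (𝓝 0) := by
  have := (tendsto_mul_gammaRatio (s := 2 * ratio a b c) (by linarith [h.large]) hτ).const_mul
    (varConst a b c)
  rwa [mul_zero] at this

theorem mass_add (a b : ℕ) (v w : ℕ × ℕ) : mass a b (v + w) = mass a b v + mass a b w := by
  simp only [mass, Prod.fst_add, Prod.snd_add]
  push_cast
  ring

theorem u₂_add (a b c : ℕ) (v w : ℕ × ℕ) : u₂ a b c (v + w) = u₂ a b c v + u₂ a b c w := by
  simp only [u₂, Prod.fst_add, Prod.snd_add]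
  push_cast
  ring

/-- The u₂² contribution is absorbed by the squared mean through `gammaRatio_two_mul_le`; only the A
τ part of the energy remains. -/
theorem IsLarge.energy_mul_sub_le (h : IsLarge a b c d) {v : ℕ × ℕ} (hv : v ≠ 0) :
    energy a b c v * gammaRatio (2 * ratio a b c) (mass a b v)
      - (u₂ a b c v * gammaRatio (ratio a b c) (mass a b v)) ^ 2 ≤ varBound a b c (mass a b v) := by
  have h1 := mul_le_mul_of_nonneg_left (gammaRatio_two_mul_le h.ratio_pos (h.mass_pos hv))
    (sq_nonneg (u₂ a b c v))
  rw [varBound, energy]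
  linarith

theorem IsLarge.norm_charFun_sub_le (h : IsLarge a b c d) {v : ℕ × ℕ} (hv : v ≠ 0) (t : ℝ) {ε : ℝ}
    (hε : 0 < ε) :
    ‖charFun (limitLaw a b c d v.1 v.2) t - Complex.exp
        (t * ↑(u₂ a b c v * gammaRatio (ratio a b c) (mass a b v)) * Complex.I)‖
      ≤ |t| * (ε + varBound a b c (mass a b v) / ε) := by
  have := h.isProbabilityMeasure_limitLaw hv
  have hm := h.hasMoments hv
  have h0 := h.energy_mul_sub_le hv
  set r := u₂ a b c v * gammaRatio (ratio a b c) (mass a b v)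
  have i1 := hm.integrable.const_mul (2 * r)
  have hexp : ∀ x : ℝ, (x - r) ^ 2 = x ^ 2 - 2 * r * x + r ^ 2 := fun x => by ring
  rw [charFun_apply_real]
  refine norm_integral_exp_sub_le (Y := fun x => x) aemeasurable_id hε ?_ ?_
  · simp only [hexp]
    exact (hm.integrable_sq.sub i1).add (integrable_const _)
  · simp only [hexp]
    rw [integral_add (by exact hm.integrable_sq.sub i1) (integrable_const _),
      integral_sub hm.integrable_sq i1, integral_const_mul, hm.mean]
    have := hm.sq_le
    simp only [integral_const, probReal_univ, one_smul]
    linarith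

/-- For a fixed value x of B the integrand is the characteristic function of x^σ W_v + (1 - x)^σ
W_w. Its mean square distance to r is at most V(x), and the beta average of V is exactly energy(v+w)
Γ(τ)/Γ(τ + 2σ) - r², with τ = τ(v+w), as in the unsplit case. -/
theorem IsLarge.norm_splitFun_sub_le (h : IsLarge a b c d) {v w : ℕ × ℕ} (hv : v ≠ 0) (hw : w ≠ 0)
    (t : ℝ) {ε : ℝ} (hε : 0 < ε) :
    ‖splitFun a b c d v w t - Complex.exp
        (t * ↑(u₂ a b c (v + w) * gammaRatio (ratio a b c) (mass a b (v + w))) * Complex.I)‖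
      ≤ |t| * (ε + varBound a b c (mass a b (v + w)) / ε) := by
  have hvw : v + w ≠ 0 := by
    intro h0
    exact hv (add_eq_zero.1 h0).1
  have := h.isProbabilityMeasure_limitLaw hv
  have := h.isProbabilityMeasure_limitLaw hw
  have hp := h.mass_pos hv
  have hq := h.mass_pos hw
  have := isProbabilityMeasureBeta hp hq
  have hmv := h.hasMoments hv
  have hmw := h.hasMoments hw
  have hσ := h.ratio_pos
  have hvar := h.energy_mul_sub_le hvw
  set σ := ratio a b c
  set p := mass a b v
  set q := mass a b w
  have hpq : mass a b (v + w) = p + q := mass_add a b v w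
  rw [hpq] at hvar ⊢
  set r := u₂ a b c (v + w) * gammaRatio σ (p + q) with hr
  set rv := u₂ a b c v * gammaRatio σ p with hrv
  set rw' := u₂ a b c w * gammaRatio σ q with hrw
  set qv := energy a b c v * gammaRatio (2 * σ) p with hqv
  set qw := energy a b c w * gammaRatio (2 * σ) q with hqw
  set μ := limitLaw a b c d v.1 v.2
  set ν := limitLaw a b c d w.1 w.2
  -- The zero powers give every term the shape x^s (1 - x)^u of the beta moment formulas.
  let V : ℝ → ℝ := fun x => qv * (x ^ (2 * σ) * (1 - x) ^ (0 : ℝ))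
    + qw * (x ^ (0 : ℝ) * (1 - x) ^ (2 * σ)) + 2 * (rv * rw') * (x ^ σ * (1 - x) ^ σ)
    - (2 * r * rv * (x ^ σ * (1 - x) ^ (0 : ℝ)) + 2 * r * rw' * (x ^ (0 : ℝ) * (1 - x) ^ σ))
    + r ^ 2
  have i1 := (integrable_beta_moment (s := 2 * σ) (u := 0) hp hq (by positivity) le_rfl).const_mul qv
  have i2 := (integrable_beta_moment (s := 0) (u := 2 * σ) hp hq le_rfl (by positivity)).const_mul qw
  have i3 := (integrable_beta_moment (s := σ) (u := σ) hp hq hσ.le hσ.le).const_mul (2 * (rv * rw'))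
  have i4 := (integrable_beta_moment (s := σ) (u := 0) hp hq hσ.le le_rfl).const_mul (2 * r * rv)
  have i5 := (integrable_beta_moment (s := 0) (u := σ) hp hq le_rfl hσ.le).const_mul (2 * r * rw')
  have j1 := i1.add i2
  have j2 := j1.add i3
  have j3 := i4.add i5
  have j4 := j2.sub j3
  have iV : Integrable V (betaMeasure p q) := j4.add (integrable_const _)
  have hVint : ∫ x, V x ∂(betaMeasure p q) ≤ varBound a b c (p + q) := by
    refine le_trans (le_of_eq ?_) hvar
    simp only [V]
    rw [integral_add (by exact j4) (integrable_const _), integral_sub (by exact j2) (by exact j3),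
      integral_add (by exact j1) i3, integral_add i1 i2, integral_add i4 i5]
    simp only [integral_const_mul, integral_const, probReal_univ, one_smul]
    rw [integral_beta_moment hp hq (by positivity) le_rfl,
      integral_beta_moment hp hq le_rfl (by positivity), integral_beta_moment hp hq hσ.le hσ.le,
      integral_beta_moment hp hq hσ.le le_rfl, integral_beta_moment hp hq le_rfl hσ.le,
      beta_left_div_beta hp hq (by positivity), beta_right_div_beta hp hq (by positivity),
      beta_both_div_beta hp hq hσ, beta_left_div_beta hp hq hσ, beta_right_div_beta hp hq hσ]
    have e1 : energy a b c (v + w) = energy a b c v + energy a b c w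
        + 2 * (u₂ a b c v * u₂ a b c w) := by
      simp only [energy, u₂_add, mass_add]
      ring
    have g1 := gammaRatio_pos hσ hp
    have g2 := gammaRatio_pos hσ hq
    have g3 := gammaRatio_pos (s := 2 * σ) (by positivity) hp
    have g4 := gammaRatio_pos (s := 2 * σ) (by positivity) hq
    rw [e1, hqv, hqw, hrv, hrw, hr, u₂_add]
    field_simp
    ring
  have hpt : ∀ x ∈ Set.Ioo (0 : ℝ) 1,
      ‖charFun μ (t * x ^ σ) * charFun ν (t * (1 - x) ^ σ) - Complex.exp (t * r * Complex.I)‖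
        ≤ |t| * (ε + V x / ε) := by
    intro x hx
    have hx1 : 0 ≤ 1 - x := by linarith [hx.2]
    have hc := hmv.integral_combination_le hmw (x ^ σ) ((1 - x) ^ σ) r
    have hprod : charFun μ (t * x ^ σ) * charFun ν (t * (1 - x) ^ σ) =
        ∫ z : ℝ × ℝ, Complex.exp (t * ↑(x ^ σ * z.1 + (1 - x) ^ σ * z.2) * Complex.I)
          ∂(μ.prod ν) := by
      rw [charFun_apply_real, charFun_apply_real, ← integral_prod_mul]
      congr with z
      rw [← Complex.exp_add]
      congr 1
      push_cast
      ring
    rw [hprod]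
    refine norm_integral_exp_sub_le (by fun_prop) hε hc.1 (hc.2.trans (le_of_eq ?_))
    simp only [V, Real.rpow_zero, mul_one, one_mul]
    rw [mul_comm 2 σ, Real.rpow_mul hx.1.le, Real.rpow_mul hx1, Real.rpow_two, Real.rpow_two]
    ring
  have hmeas : AEStronglyMeasurable (fun x : ℝ => charFun μ (t * x ^ σ) *
      charFun ν (t * (1 - x) ^ σ)) (betaMeasure p q) := by
    have h1 : Measurable (charFun μ) := measurable_charFun
    have h2 : Measurable (charFun ν) := measurable_charFun
    have : Measurable (fun x : ℝ => charFun μ (t * x ^ σ) * charFun ν (t * (1 - x) ^ σ)) := by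
      fun_prop
    exact this.aestronglyMeasurable
  have hint : Integrable (fun x : ℝ => charFun μ (t * x ^ σ) *
      charFun ν (t * (1 - x) ^ σ)) (betaMeasure p q) := by
    refine .of_bound (C := 1) hmeas (.of_forall fun x => ?_)
    rw [norm_mul]
    exact mul_le_one₀ (norm_charFun_le_one _) (norm_nonneg _) (norm_charFun_le_one _)
  have hsub : splitFun a b c d v w t - Complex.exp (t * r * Complex.I) =
      ∫ x, (charFun μ (t * x ^ σ) * charFun ν (t * (1 - x) ^ σ)
        - Complex.exp (t * r * Complex.I)) ∂(betaMeasure p q) := by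
    rw [integral_sub hint (integrable_const _)]
    simp [splitFun, μ, ν, p, q, σ]
  rw [hsub]
  refine (norm_integral_le_of_norm_le (g := fun x => |t| * (ε + V x / ε))
    (((integrable_const _).add (iV.div_const _)).const_mul _) ?_).trans ?_
  · filter_upwards [betaMeasure_ae_mem] with x hx using hpt x hx
  · rw [integral_const_mul, integral_add (integrable_const _) (iV.div_const _), integral_div]
    simp only [integral_const, probReal_univ, one_smul]
    gcongr

end Split

/-! ### The two-part splitting identity by a maximum principle. -/

section Harmonic

variable {a b c d : ℕ}

/-- One step of the urn when the composition is split into the parts `v` and `w`. -/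
noncomputable def pairMean (a b c d : ℕ) (f : ℕ × ℕ → ℕ × ℕ → ℂ) (v w : ℕ × ℕ) : ℂ :=
  (mass a b v / (mass a b v + mass a b w)) • stepMean a b c d (fun v' => f v' w) v
    + (mass a b w / (mass a b v + mass a b w)) • stepMean a b c d (fun w' => f v w') w

theorem IsLarge.pairMean_eq (h : IsLarge a b c d) (f : ℕ × ℕ → ℕ × ℕ → ℂ) {v w : ℕ × ℕ}
    (hv : v ≠ 0) (hw : w ≠ 0) :
    pairMean a b c d f v w =
      ((v.1 : ℝ) / (v.1 + v.2 + (w.1 + w.2))) • f (v.1 + a, v.2 + b) w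
      + ((v.2 : ℝ) / (v.1 + v.2 + (w.1 + w.2))) • f (v.1 + c, v.2 + d) w
      + ((w.1 : ℝ) / (v.1 + v.2 + (w.1 + w.2))) • f v (w.1 + a, w.2 + b)
      + ((w.2 : ℝ) / (v.1 + v.2 + (w.1 + w.2))) • f v (w.1 + c, w.2 + d) := by
  have hS := h.sum_pos
  have h1 := cast_add_cast_pos hv
  have h2 := cast_add_cast_pos hw
  have e1 : mass a b v / (mass a b v + mass a b w)
      = ((v.1 : ℝ) + v.2) / (v.1 + v.2 + (w.1 + w.2)) := by
    rw [mass, mass]; field_simp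
  have e2 : mass a b w / (mass a b v + mass a b w)
      = ((w.1 : ℝ) + w.2) / (v.1 + v.2 + (w.1 + w.2)) := by
    rw [mass, mass]; field_simp
  have key : ∀ x y z : ℝ, y ≠ 0 → y / z * (x / y) = x / z := fun x y z hy => by
    field_simp
  rw [pairMean, e1, e2]
  simp only [stepMean, smul_add, smul_smul, key _ _ _ h1.ne', key _ _ _ h2.ne']
  ring

/-- Maximum principle: `pairMean` is a convex combination of the four successor values. -/
theorem IsLarge.norm_pairMean_le (h : IsLarge a b c d) {f : ℕ × ℕ → ℕ × ℕ → ℂ} {v w : ℕ × ℕ}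
    (hv : v ≠ 0) (hw : w ≠ 0) {C : ℝ} (h1 : ‖f (v.1 + a, v.2 + b) w‖ ≤ C)
    (h2 : ‖f (v.1 + c, v.2 + d) w‖ ≤ C) (h3 : ‖f v (w.1 + a, w.2 + b)‖ ≤ C)
    (h4 : ‖f v (w.1 + c, w.2 + d)‖ ≤ C) : ‖pairMean a b c d f v w‖ ≤ C := by
  rw [h.pairMean_eq f hv hw]
  have hv' := cast_add_cast_pos hv
  have hw' := cast_add_cast_pos hw
  have key : ∀ (x : ℝ) (z : ℂ), 0 ≤ x → ‖z‖ ≤ C → ‖x • z‖ ≤ x * C := fun x z hx hz => by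
    rw [norm_smul, Real.norm_of_nonneg hx]
    exact mul_le_mul_of_nonneg_left hz hx
  refine (norm_add_le_of_le (norm_add_le_of_le (norm_add_le_of_le (key _ _ (by positivity) h1)
    (key _ _ (by positivity) h2)) (key _ _ (by positivity) h3))
    (key _ _ (by positivity) h4)).trans (le_of_eq ?_)
  field_simp
  ring

theorem IsLarge.charFun_add_eq_pairMean (h : IsLarge a b c d) {v w : ℕ × ℕ} (hv : v ≠ 0)
    (hw : w ≠ 0) (t : ℝ) :
    charFun (limitLaw a b c d (v + w).1 (v + w).2) t =
      pairMean a b c d (fun v w => charFun (limitLaw a b c d (v + w).1 (v + w).2) t) v w := by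
  have hvw : v + w ≠ 0 := fun h0 => hv (add_eq_zero.1 h0).1
  rw [h.pairMean_eq _ hv hw, h.charFun_eq_stepMean hvw t]
  have e1 : v.1 + w.1 + a = v.1 + a + w.1 := by ring
  have e2 : v.2 + w.2 + b = v.2 + b + w.2 := by ring
  have e3 : v.1 + w.1 + c = v.1 + c + w.1 := by ring
  have e4 : v.2 + w.2 + d = v.2 + d + w.2 := by ring
  simp only [stepMean, Prod.fst_add, Prod.snd_add, ← add_assoc]
  rw [e1, e2, e3, e4]
  push_cast
  have e5 : (v.1 : ℝ) + w.1 + (v.2 + w.2) = v.1 + v.2 + w.1 + w.2 := by ring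
  simp only [e5, add_div, add_smul, Complex.real_smul]
  ring

theorem IsLarge.integrable_split (h : IsLarge a b c d) {v w : ℕ × ℕ} (hv : v ≠ 0) (hw : w ≠ 0)
    {p q : ℝ} (hp : 0 < p) (hq : 0 < q) (t : ℝ) :
    Integrable (fun x : ℝ => charFun (limitLaw a b c d v.1 v.2) (t * x ^ ratio a b c) *
      charFun (limitLaw a b c d w.1 w.2) (t * (1 - x) ^ ratio a b c)) (betaMeasure p q) := by
  have := h.isProbabilityMeasure_limitLaw hv
  have := h.isProbabilityMeasure_limitLaw hw
  have := isProbabilityMeasureBeta hp hq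
  have h1 : Measurable (charFun (limitLaw a b c d v.1 v.2)) := measurable_charFun
  have h2 : Measurable (charFun (limitLaw a b c d w.1 w.2)) := measurable_charFun
  have hm : Measurable (fun x : ℝ => charFun (limitLaw a b c d v.1 v.2) (t * x ^ ratio a b c) *
      charFun (limitLaw a b c d w.1 w.2) (t * (1 - x) ^ ratio a b c)) := by fun_prop
  refine .of_bound (C := 1) hm.aestronglyMeasurable (.of_forall fun x => ?_)
  rw [norm_mul]
  exact mul_le_one₀ (norm_charFun_le_one _) (norm_nonneg _) (norm_charFun_le_one _)

/-- Splitting the beta law raises the mass parameter of one part by 1. The first-step equation of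
that part's characteristic function then supplies the draw inside it, which raises its mass by the
same amount. -/
theorem IsLarge.splitFun_eq_pairMean (h : IsLarge a b c d) {v w : ℕ × ℕ} (hv : v ≠ 0)
    (hw : w ≠ 0) (t : ℝ) :
    splitFun a b c d v w t = pairMean a b c d (fun v w => splitFun a b c d v w t) v w := by
  have hp := h.mass_pos hv
  have hq := h.mass_pos hw
  have hp1 : 0 < mass a b v + 1 := by positivity
  have hq1 : 0 < mass a b w + 1 := by positivity
  rw [splitFun, integral_betaMeasure_split hp hq (h.integrable_split hv hw hp1 hq t)
    (h.integrable_split hv hw hp hq1 t), pairMean]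
  congr 2
  · simp only [stepMean, splitFun, h.mass_red, h.mass_black]
    rw [← integral_smul, ← integral_smul, ← integral_add
      (by exact (h.integrable_split (h.red_ne v) hw hp1 hq t).smul ((v.1 : ℝ) / (v.1 + v.2)))
      (by exact (h.integrable_split (h.black_ne v) hw hp1 hq t).smul ((v.2 : ℝ) / (v.1 + v.2)))]
    congr with x
    rw [h.charFun_eq_stepMean hv, stepMean, add_mul, smul_mul_assoc, smul_mul_assoc]
  · simp only [stepMean, splitFun, h.mass_red, h.mass_black]
    rw [← integral_smul, ← integral_smul, ← integral_add
      (by exact (h.integrable_split hv (h.red_ne w) hp hq1 t).smul ((w.1 : ℝ) / (w.1 + w.2)))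
      (by exact (h.integrable_split hv (h.black_ne w) hp hq1 t).smul ((w.2 : ℝ) / (w.1 + w.2)))]
    congr with x
    rw [h.charFun_eq_stepMean hw, stepMean, mul_add, mul_smul_comm, mul_smul_comm]

/-- The difference is harmonic, so its norm is bounded by that at the pairs reached after n draws.
All of these have total mass raised by n, which makes the concentration bound uniform over them. -/
theorem IsLarge.norm_charFun_add_sub_splitFun_le (h : IsLarge a b c d) {v w : ℕ × ℕ} (hv : v ≠ 0)
    (hw : w ≠ 0) (t : ℝ) {ε : ℝ} (hε : 0 < ε) (n : ℕ) :
    ‖charFun (limitLaw a b c d (v + w).1 (v + w).2) t - splitFun a b c d v w t‖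
      ≤ 2 * (|t| * (ε + varBound a b c (mass a b (v + w) + n) / ε)) := by
  induction n generalizing v w with
  | zero =>
    have hvw : v + w ≠ 0 := fun h0 => hv (add_eq_zero.1 h0).1
    have h1 := h.norm_charFun_sub_le hvw t hε
    have h2 := h.norm_splitFun_sub_le hv hw t hε
    rw [norm_sub_rev] at h2
    have h3 := norm_sub_le_norm_sub_add_norm_sub
      (charFun (limitLaw a b c d (v + w).1 (v + w).2) t)
      (Complex.exp (t * ↑(u₂ a b c (v + w) * gammaRatio (ratio a b c) (mass a b (v + w)))
        * Complex.I)) (splitFun a b c d v w t)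
    simp only [Nat.cast_zero, add_zero]
    linarith
  | succ n ih =>
    have e : charFun (limitLaw a b c d (v + w).1 (v + w).2) t - splitFun a b c d v w t =
        pairMean a b c d (fun v w => charFun (limitLaw a b c d (v + w).1 (v + w).2) t
          - splitFun a b c d v w t) v w := by
      rw [h.charFun_add_eq_pairMean hv hw, h.splitFun_eq_pairMean hv hw]
      simp only [pairMean, stepMean, smul_sub, smul_add]
      ring
    have hm : ∀ τ : ℝ, τ = mass a b (v + w) + 1 →
        mass a b (v + w) + ((n + 1 : ℕ) : ℝ) = τ + n := fun τ hτ => by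
      rw [hτ]; push_cast; ring
    rw [e]
    refine h.norm_pairMean_le hv hw ?_ ?_ ?_ ?_
    · rw [hm (mass a b ((v.1 + a, v.2 + b) + w)) (by rw [mass_add, mass_add, h.mass_red]; ring)]
      exact ih (h.red_ne v) hw
    · rw [hm (mass a b ((v.1 + c, v.2 + d) + w)) (by rw [mass_add, mass_add, h.mass_black]; ring)]
      exact ih (h.black_ne v) hw
    · rw [hm (mass a b (v + (w.1 + a, w.2 + b))) (by rw [mass_add, mass_add, h.mass_red]; ring)]
      exact ih hv (h.red_ne w)
    · rw [hm (mass a b (v + (w.1 + c, w.2 + d))) (by rw [mass_add, mass_add, h.mass_black]; ring)]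
      exact ih hv (h.black_ne w)

/-- The law of `W_(v + w)` is that of `B ^ σ * W_v + (1 - B) ^ σ * W_w`. -/
theorem IsLarge.charFun_add (h : IsLarge a b c d) {v w : ℕ × ℕ} (hv : v ≠ 0) (hw : w ≠ 0) (t : ℝ) :
    charFun (limitLaw a b c d (v + w).1 (v + w).2) t = splitFun a b c d v w t := by
  have hvw : v + w ≠ 0 := fun h0 => hv (add_eq_zero.1 h0).1
  -- First n → ∞ with ε fixed, which removes the variance; then ε → 0.
  have key : ∀ ε : ℝ, 0 < ε →
      ‖charFun (limitLaw a b c d (v + w).1 (v + w).2) t - splitFun a b c d v w t‖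
        ≤ 2 * (|t| * (ε + 0 / ε)) := fun ε hε =>
    ge_of_tendsto' ((((h.tendsto_varBound (h.mass_pos hvw)).div_const ε).const_add ε).const_mul
      |t| |>.const_mul 2) fun n => h.norm_charFun_add_sub_splitFun_le hv hw t hε n
  rw [← sub_eq_zero, ← norm_le_zero_iff]
  have hlim : Tendsto (fun ε : ℝ => 2 * (|t| * (ε + 0 / ε))) (𝓝[>] 0) (𝓝 0) := by
    have : Tendsto (fun ε : ℝ => 2 * (|t| * ε)) (𝓝 0) (𝓝 (2 * (|t| * 0))) := by
      apply Continuous.tendsto; fun_prop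
    simp only [mul_zero] at this
    simpa using this.mono_left nhdsWithin_le_nhds
  exact ge_of_tendsto hlim (by filter_upwards [self_mem_nhdsWithin] with ε hε using key ε hε)

end Harmonic

/-! ### Dirichlet distributions and stick-breaking. -/

section Dirichlet

open scoped Classical in
/-- The density of the Dirichlet distribution in the first coordinates. -/
noncomputable def dirichletDensity {n : ℕ} (ν : Fin (n + 1) → ℝ) (x : Fin n → ℝ) : ℝ≥0∞ :=
  if (∀ i, 0 ≤ x i) ∧ ∑ i, x i ≤ 1 then
    ENNReal.ofReal (Real.Gamma (∑ k, ν k) / (∏ k, Real.Gamma (ν k))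
      * ∏ k, simplexPoint x k ^ (ν k - 1))
  else 0

theorem dirichlet_succ {n : ℕ} (ν : Fin (n + 1) → ℝ) :
    dirichlet (n + 1) ν = (volume.withDensity (dirichletDensity ν)).map simplexPoint := rfl

@[simp]
theorem simplexPoint_castSucc {n : ℕ} (x : Fin n → ℝ) (i : Fin n) :
    simplexPoint x i.castSucc = x i := by simp [simplexPoint]

@[simp]
theorem simplexPoint_last {n : ℕ} (x : Fin n → ℝ) :
    simplexPoint x (Fin.last n) = 1 - ∑ i, x i := by simp [simplexPoint]

theorem measurable_simplexPoint {n : ℕ} : Measurable (simplexPoint (n := n)) := by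
  refine measurable_pi_iff.2 fun k => ?_
  induction k using Fin.lastCases with
  | last => simp only [simplexPoint_last]; fun_prop
  | cast i => simp only [simplexPoint_castSucc]; fun_prop

theorem measurable_simplexPoint_apply {n : ℕ} (k : Fin (n + 1)) :
    Measurable (fun x : Fin n → ℝ => simplexPoint x k) :=
  (measurable_pi_apply k).comp measurable_simplexPoint

theorem measurable_dirichletDensity {n : ℕ} (ν : Fin (n + 1) → ℝ) :
    Measurable (dirichletDensity ν) := by
  refine Measurable.ite ?_ ?_ measurable_const
  · have h1 : MeasurableSet {x : Fin n → ℝ | ∀ i, 0 ≤ x i} := by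
      simp only [Set.ofPred_forall]
      exact MeasurableSet.iInter fun i => measurableSet_le measurable_const (measurable_pi_apply i)
    have h2 : MeasurableSet {x : Fin n → ℝ | ∑ i, x i ≤ 1} :=
      measurableSet_le (by fun_prop) measurable_const
    exact h1.inter h2
  · exact ((Finset.measurable_prod _ fun k _ =>
      (measurable_simplexPoint_apply k).pow_const _).const_mul _).ennreal_ofReal

theorem lintegral_dirichlet {n : ℕ} (ν : Fin (n + 1) → ℝ) {f : (Fin (n + 1) → ℝ) → ℝ≥0∞}
    (hf : Measurable f) :
    ∫⁻ z, f z ∂(dirichlet (n + 1) ν) = ∫⁻ x, dirichletDensity ν x * f (simplexPoint x) := by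
  rw [dirichlet_succ, lintegral_map hf measurable_simplexPoint,
    lintegral_withDensity_eq_lintegral_mul _ (measurable_dirichletDensity ν)
      (by exact hf.comp measurable_simplexPoint)]
  rfl

instance {n : ℕ} (ν : Fin (n + 1) → ℝ) : SFinite (dirichlet (n + 1) ν) := by
  rw [dirichlet_succ]
  infer_instance

theorem simplexPoint_nonneg {n : ℕ} {x : Fin n → ℝ} (hx : (∀ i, 0 ≤ x i) ∧ ∑ i, x i ≤ 1)
    (k : Fin (n + 1)) : 0 ≤ simplexPoint x k := by
  induction k using Fin.lastCases with
  | last => simpa using hx.2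
  | cast i => simpa using hx.1 i

theorem dirichlet_ae_nonneg {n : ℕ} (ν : Fin (n + 1) → ℝ) :
    ∀ᵐ z ∂(dirichlet (n + 1) ν), ∀ k, 0 ≤ z k := by
  have hm : MeasurableSet {z : Fin (n + 1) → ℝ | ∀ k, 0 ≤ z k} := by
    simp only [Set.ofPred_forall]
    exact MeasurableSet.iInter fun i => measurableSet_le measurable_const (measurable_pi_apply i)
  rw [dirichlet_succ, ae_map_iff measurable_simplexPoint.aemeasurable hm,
    ae_withDensity_iff (measurable_dirichletDensity ν)]
  refine .of_forall fun x hx => simplexPoint_nonneg ?_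
  by_contra h
  exact hx (if_neg h)

theorem simplexPoint_cons {n : ℕ} (x : ℝ) (y : Fin n → ℝ) :
    simplexPoint (Fin.cons x ((1 - x) • y) : Fin (n + 1) → ℝ) =
      Fin.cons x ((1 - x) • simplexPoint y) := by
  ext k
  induction k using Fin.lastCases with
  | last =>
    rw [simplexPoint_last, ← Fin.succ_last, Fin.cons_succ, Fin.sum_univ_succ]
    simp only [Fin.cons_zero, Fin.cons_succ, Pi.smul_apply, smul_eq_mul, simplexPoint_last,
      ← Finset.mul_sum]
    ring
  | cast i =>
    rw [simplexPoint_castSucc]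
    induction i using Fin.cases with
    | zero => simp
    | succ j => rw [Fin.castSucc_succ]; simp

theorem mem_simplex_cons_iff {n : ℕ} {x : ℝ} (hx : x ∈ Set.Ioo (0 : ℝ) 1) (y : Fin n → ℝ) :
    ((∀ i, 0 ≤ (Fin.cons x ((1 - x) • y) : Fin (n + 1) → ℝ) i) ∧
      ∑ i, (Fin.cons x ((1 - x) • y) : Fin (n + 1) → ℝ) i ≤ 1) ↔
      (∀ i, 0 ≤ y i) ∧ ∑ i, y i ≤ 1 := by
  have h1 : 0 < 1 - x := by linarith [hx.2]
  rw [Fin.forall_fin_succ, Fin.sum_univ_succ]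
  simp only [Fin.cons_zero, Fin.cons_succ, Pi.smul_apply, smul_eq_mul, ← Finset.mul_sum]
  refine and_congr ?_ ?_
  · simp [hx.1.le, mul_nonneg_iff_of_pos_left h1]
  · constructor
    · intro h
      by_contra hc
      push Not at hc
      nlinarith
    · intro h
      nlinarith

/-- The factor (1 - x)^n is the Jacobian of y ↦ (1 - x) y on the remaining n free coordinates. The
powers of 1 - x collect to the exponent ∑ (tail) - 1 of the beta density. -/
theorem dirichletDensity_cons {n : ℕ} {ν : Fin (n + 2) → ℝ} (hν : ∀ k, 0 < ν k) {x : ℝ}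
    (hx : x ∈ Set.Ioo (0 : ℝ) 1) (y : Fin n → ℝ) :
    ENNReal.ofReal ((1 - x) ^ n) * dirichletDensity ν (Fin.cons x ((1 - x) • y)) =
      betaPDF (ν 0) (∑ k, Fin.tail ν k) x * dirichletDensity (Fin.tail ν) y := by
  have h1 : 0 < 1 - x := by linarith [hx.2]
  by_cases hy : (∀ i, 0 ≤ y i) ∧ ∑ i, y i ≤ 1
  · have hz := simplexPoint_nonneg hy
    have hB := beta_pos (hν 0) (Finset.sum_pos (fun k _ => hν (Fin.succ k))
      (Finset.univ_nonempty (α := Fin (n + 1))))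
    rw [dirichletDensity, if_pos ((mem_simplex_cons_iff hx y).2 hy), dirichletDensity, if_pos hy,
      betaPDF_of_pos_lt_one hx.1 hx.2, ← ENNReal.ofReal_mul (by positivity),
      ← ENNReal.ofReal_mul (by
        have : 0 < beta (ν 0) (∑ k, Fin.tail ν k) := hB
        have := hx.1
        positivity)]
    congr 1
    have q1 : ∏ k, Real.Gamma (ν k) = Real.Gamma (ν 0) * ∏ k, Real.Gamma (Fin.tail ν k) :=
      Fin.prod_univ_succ _
    have q2 : ∏ k, (Fin.cons x ((1 - x) • simplexPoint y) : Fin (n + 2) → ℝ) k ^ (ν k - 1) =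
        x ^ (ν 0 - 1) * ∏ k, ((1 - x) * simplexPoint y k) ^ (Fin.tail ν k - 1) :=
      Fin.prod_univ_succ _
    have q3 : ∑ k, ν k = ν 0 + ∑ k, Fin.tail ν k := Fin.sum_univ_succ _
    rw [simplexPoint_cons, q1, q2, q3]
    change 0 < beta (ν 0) (∑ k, Fin.tail ν k) at hB
    have hs : 0 < ∑ k, Fin.tail ν k := Finset.sum_pos (fun k _ => hν (Fin.succ k))
      Finset.univ_nonempty
    have hpow : ∏ k, ((1 - x) * simplexPoint y k) ^ (Fin.tail ν k - 1) =
        (1 - x) ^ (∑ k, Fin.tail ν k - (n + 1)) * ∏ k, simplexPoint y k ^ (Fin.tail ν k - 1) := by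
      rw [show ∑ k, Fin.tail ν k - ((n : ℝ) + 1) = ∑ k, (Fin.tail ν k - 1) by
        simp [Finset.sum_sub_distrib], Real.rpow_sum_of_pos h1,
        ← Finset.prod_mul_distrib]
      exact Finset.prod_congr rfl fun k _ => Real.mul_rpow h1.le (hz k)
    have hpow2 : (1 - x) ^ n * (1 - x) ^ (∑ k, Fin.tail ν k - ((n : ℝ) + 1)) =
        (1 - x) ^ (∑ k, Fin.tail ν k - 1) := by
      rw [← Real.rpow_natCast, ← Real.rpow_add h1]
      congr 1
      ring
    rw [hpow, ← hpow2, beta]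
    have g0 := Real.Gamma_pos_of_pos (hν 0)
    have g1 := Real.Gamma_pos_of_pos hs
    have g2 := Real.Gamma_pos_of_pos (add_pos (hν 0) hs)
    have g3 : 0 < ∏ k, Real.Gamma (Fin.tail ν k) :=
      Finset.prod_pos fun k _ => Real.Gamma_pos_of_pos (hν _)
    field_simp
  · have h2 : dirichletDensity (Fin.tail ν) y = 0 := if_neg hy
    have h3 : dirichletDensity ν (Fin.cons x ((1 - x) • y)) = 0 :=
      if_neg fun h => hy ((mem_simplex_cons_iff hx y).1 h)
    rw [h2, h3, mul_zero, mul_zero]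

theorem lintegral_comp_smul_pi {n : ℕ} {r : ℝ} (hr : 0 < r) {g : (Fin n → ℝ) → ℝ≥0∞}
    (hg : Measurable g) :
    ∫⁻ y, g y = ENNReal.ofReal (r ^ n) * ∫⁻ y, g (r • y) := by
  have h := Measure.map_addHaar_smul (volume : Measure (Fin n → ℝ)) hr.ne'
  rw [← lintegral_map hg (measurable_const_smul r), h, lintegral_smul_measure, smul_eq_mul,
    ← mul_assoc, ← ENNReal.ofReal_mul (by positivity)]
  have : r ^ n * |(r ^ Module.finrank ℝ (Fin n → ℝ))⁻¹| = 1 := by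
    rw [Module.finrank_fin_fun, abs_of_pos (by positivity)]
    field_simp
  rw [this, ENNReal.ofReal_one, one_mul]

theorem dirichletDensity_cons_eq_zero {n : ℕ} (ν : Fin (n + 2) → ℝ) {x : ℝ} (hx : x < 0 ∨ 1 < x)
    (y : Fin n → ℝ) : dirichletDensity ν (Fin.cons x y) = 0 := by
  refine if_neg fun h => ?_
  have h0 := h.1 0
  have h1 := h.2
  rw [Fin.sum_univ_succ] at h1
  simp only [Fin.cons_zero, Fin.cons_succ] at h0 h1
  have h2 : 0 ≤ ∑ i, y i := Finset.sum_nonneg fun i _ => by simpa using h.1 (Fin.succ i)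
  rcases hx with hx | hx <;> linarith

theorem measurable_cons {n : ℕ} :
    Measurable (fun p : ℝ × (Fin n → ℝ) => (Fin.cons p.1 p.2 : Fin (n + 1) → ℝ)) := by
  refine measurable_pi_iff.2 fun k => ?_
  induction k using Fin.cases with
  | zero => simp only [Fin.cons_zero]; fun_prop
  | succ i => simp only [Fin.cons_succ]; fun_prop

theorem measurable_cons_smul {n : ℕ} :
    Measurable (fun p : ℝ × (Fin n → ℝ) =>
      (Fin.cons p.1 ((1 - p.1) • p.2) : Fin (n + 1) → ℝ)) :=
  measurable_cons.comp (f := fun p : ℝ × (Fin n → ℝ) => (p.1, (1 - p.1) • p.2)) (by fun_prop)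

/-- A Dirichlet vector is obtained from a beta variable and a Dirichlet vector with one coordinate
less. -/
theorem dirichlet_eq_map_prod {n : ℕ} {ν : Fin (n + 2) → ℝ} (hν : ∀ k, 0 < ν k) :
    dirichlet (n + 2) ν =
      ((betaMeasure (ν 0) (∑ k, Fin.tail ν k)).prod (dirichlet (n + 1) (Fin.tail ν))).map
        (fun p => Fin.cons p.1 ((1 - p.1) • p.2)) := by
  refine Measure.ext_of_lintegral _ fun f hf => ?_
  rw [lintegral_map hf measurable_cons_smul,
    lintegral_prod _ (by exact (hf.comp measurable_cons_smul).aemeasurable), lintegral_dirichlet ν hf]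
  have hG : Measurable fun x : Fin (n + 1) → ℝ => dirichletDensity ν x * f (simplexPoint x) :=
    (measurable_dirichletDensity ν).mul (hf.comp measurable_simplexPoint)
  have e1 := (volume_preserving_piFinSuccAbove (fun _ : Fin (n + 1) => ℝ) 0).symm.lintegral_comp
    hG
  rw [← e1]
  have e2 : ∀ p : ℝ × (Fin n → ℝ),
      (MeasurableEquiv.piFinSuccAbove (fun _ : Fin (n + 1) => ℝ) 0).symm p
        = Fin.cons p.1 p.2 := by
    intro p
    simp only [MeasurableEquiv.piFinSuccAbove_symm_apply, Fin.insertNthEquiv]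
    exact Fin.insertNth_zero' _ _
  simp only [e2]
  rw [Measure.volume_eq_prod, lintegral_prod _ (by exact (hG.comp measurable_cons).aemeasurable), betaMeasure,
    lintegral_withDensity_eq_lintegral_mul _ (measurable_betaPDF _ _)]
  · refine lintegral_congr_ae ?_
    -- Off these two null points, x outside the open interval lies strictly outside [0, 1], where
    -- both densities vanish.
    have h01 : ∀ᵐ x : ℝ, x ≠ 0 ∧ x ≠ 1 :=
      (Measure.ae_ne volume 0).and (Measure.ae_ne volume 1)
    filter_upwards [h01] with x hx01
    simp only [Pi.mul_apply]
    by_cases hx : x ∈ Set.Ioo (0 : ℝ) 1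
    · have h1 : 0 < 1 - x := by linarith [hx.2]
      have hfc : Measurable fun z : Fin (n + 1) → ℝ =>
          f (Fin.cons x ((1 - x) • z) : Fin (n + 2) → ℝ) :=
        hf.comp (measurable_cons_smul.comp measurable_prodMk_left)
      have hGx : Measurable fun y : Fin n → ℝ => dirichletDensity ν (Fin.cons x y) *
          f (simplexPoint (Fin.cons x y : Fin (n + 1) → ℝ)) :=
        hG.comp (measurable_cons.comp measurable_prodMk_left)
      rw [lintegral_dirichlet _ hfc, lintegral_comp_smul_pi h1 hGx,
        ← lintegral_const_mul _ (by exact hGx.comp (measurable_const_smul (1 - x))),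
        ← lintegral_const_mul _ (by exact
          (measurable_dirichletDensity (Fin.tail ν)).mul (hfc.comp measurable_simplexPoint))]
      refine lintegral_congr fun y => ?_
      rw [← mul_assoc, dirichletDensity_cons hν hx, simplexPoint_cons, mul_assoc]
    · have h2 : x < 0 ∨ 1 < x := by
        by_contra hc
        push Not at hc
        exact hx ⟨lt_of_le_of_ne hc.1 hx01.1.symm, lt_of_le_of_ne hc.2 hx01.2⟩
      have h3 : betaPDF (ν 0) (∑ k, Fin.tail ν k) x = 0 := by
        rcases h2 with h2 | h2
        · exact betaPDF_eq_zero_of_nonpos h2.le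
        · exact betaPDF_eq_zero_of_one_le h2.le
      simp [h3, dirichletDensity_cons_eq_zero ν h2]
  · exact (hf.comp measurable_cons_smul).lintegral_prod_right'

theorem dirichlet_one {ν : Fin 1 → ℝ} (hν : 0 < ν 0) :
    dirichlet 1 ν = Measure.dirac (fun _ => 1) := by
  refine Measure.ext_of_lintegral _ fun f hf => ?_
  have hG := Real.Gamma_pos_of_pos hν
  have hp : ∀ x : Fin 0 → ℝ, simplexPoint x = fun _ => 1 := fun x => by
    ext k
    have : k = Fin.last 0 := by omega
    rw [this, simplexPoint_last]
    simp
  have hd : ∀ x : Fin 0 → ℝ, dirichletDensity ν x = 1 := fun x => by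
    rw [dirichletDensity, if_pos (by simp)]
    simp [hp, hG.ne']
  rw [lintegral_dirichlet ν hf, lintegral_dirac' _ hf]
  simp only [hp, hd, one_mul]
  rw [lintegral_const]
  simp [volume_pi]

theorem isProbabilityMeasure_dirichlet {n : ℕ} {ν : Fin (n + 1) → ℝ} (hν : ∀ k, 0 < ν k) :
    IsProbabilityMeasure (dirichlet (n + 1) ν) := by
  induction n with
  | zero =>
    rw [dirichlet_one (hν 0)]
    infer_instance
  | succ n ih =>
    have := ih (ν := Fin.tail ν) fun k => hν (Fin.succ k)
    have hs : 0 < ∑ k, Fin.tail ν k := Finset.sum_pos (fun k _ => hν (Fin.succ k))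
      Finset.univ_nonempty
    have := isProbabilityMeasureBeta (hν 0) hs
    rw [dirichlet_eq_map_prod hν]
    exact Measure.isProbabilityMeasure_map measurable_cons_smul.aemeasurable

end Dirichlet

/-! ### From two parts to arbitrarily many. -/

section Decomposition

variable {a b c d : ℕ}

theorem mass_sum (a b : ℕ) {ι : Type*} (s : Finset ι) (v : ι → ℕ × ℕ) :
    mass a b (∑ k ∈ s, v k) = ∑ k ∈ s, mass a b (v k) := by
  classical
  induction s using Finset.induction_on with
  | empty => simp [mass]
  | insert i s hi ih => rw [Finset.sum_insert hi, Finset.sum_insert hi, mass_add, ih]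

theorem IsLarge.measurable_charFun (h : IsLarge a b c d) {v : ℕ × ℕ} (hv : v ≠ 0) :
    Measurable (charFun (limitLaw a b c d v.1 v.2)) := by
  have := h.isProbabilityMeasure_limitLaw hv
  exact MeasureTheory.measurable_charFun

theorem IsLarge.norm_charFun_le_one (h : IsLarge a b c d) {v : ℕ × ℕ} (hv : v ≠ 0) (t : ℝ) :
    ‖charFun (limitLaw a b c d v.1 v.2) t‖ ≤ 1 := by
  have := h.isProbabilityMeasure_limitLaw hv
  exact MeasureTheory.norm_charFun_le_one t

theorem IsLarge.measurable_prod_charFun (h : IsLarge a b c d) {n : ℕ} {v : Fin n → ℕ × ℕ}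
    (hv : ∀ k, v k ≠ 0) (t : ℝ) :
    Measurable (fun z : Fin n → ℝ =>
      ∏ k, charFun (limitLaw a b c d (v k).1 (v k).2) (t * z k ^ ratio a b c)) :=
  Finset.measurable_prod _ fun k _ => (h.measurable_charFun (hv k)).comp (by fun_prop)

/-- Induction on the number of parts: stick-breaking separates the first part, the induction
hypothesis at the rescaled argument t (1 - x)^σ merges the others, and the two-part identity joins
the results. -/
theorem IsLarge.integral_dirichlet (h : IsLarge a b c d) {n : ℕ} {v : Fin (n + 1) → ℕ × ℕ}
    (hv : ∀ k, v k ≠ 0) (t : ℝ) :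
    ∫ z, ∏ k, charFun (limitLaw a b c d (v k).1 (v k).2) (t * z k ^ ratio a b c)
        ∂(dirichlet (n + 1) fun k => mass a b (v k)) =
      charFun (limitLaw a b c d (∑ k, v k).1 (∑ k, v k).2) t := by
  induction n generalizing t with
  | zero =>
    rw [dirichlet_one (h.mass_pos (hv 0)), integral_dirac]
    simp
  | succ n ih =>
    have hm : ∀ k, 0 < mass a b (v k) := fun k => h.mass_pos (hv k)
    have hv' : ∀ k, Fin.tail v k ≠ 0 := fun k => hv (Fin.succ k)
    have hsum : ∑ k, Fin.tail v k ≠ 0 := by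
      intro h0
      exact hv' 0 ((Finset.sum_eq_zero_iff.1 h0) 0 (Finset.mem_univ _))
    have htail : (Fin.tail fun k => mass a b (v k)) = fun k => mass a b (Fin.tail v k) := rfl
    have hms : ∑ k, mass a b (Fin.tail v k) = mass a b (∑ k, Fin.tail v k) :=
      (mass_sum a b _ _).symm
    have := isProbabilityMeasure_dirichlet (ν := fun k => mass a b (Fin.tail v k))
      fun k => hm (Fin.succ k)
    have := isProbabilityMeasureBeta (hm 0) (h.mass_pos hsum)
    rw [dirichlet_eq_map_prod hm, htail, hms,
      integral_map measurable_cons_smul.aemeasurable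
        (h.measurable_prod_charFun hv t).aestronglyMeasurable, integral_prod]
    · have hv0 : ∑ k, v k = v 0 + ∑ k, Fin.tail v k := Fin.sum_univ_succ _
      rw [hv0]
      rw [h.charFun_add (hv 0) hsum, splitFun]
      refine integral_congr_ae ?_
      filter_upwards [betaMeasure_ae_mem] with x hx
      have h1 : 0 ≤ 1 - x := by linarith [hx.2]
      rw [← ih hv', ← integral_const_mul]
      refine integral_congr_ae ?_
      filter_upwards [dirichlet_ae_nonneg _] with z hz
      rw [Fin.prod_univ_succ]
      simp only [Fin.cons_zero, Fin.cons_succ, Pi.smul_apply, smul_eq_mul]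
      congr 1
      refine Finset.prod_congr rfl fun k _ => ?_
      rw [Real.mul_rpow h1 (hz k), mul_assoc]
      rfl
    · refine .of_bound (C := 1)
        ((h.measurable_prod_charFun hv t).comp measurable_cons_smul).aestronglyMeasurable
        (.of_forall fun p => ?_)
      rw [norm_prod]
      exact Finset.prod_le_one (fun _ _ => norm_nonneg _) fun k _ => h.norm_charFun_le_one (hv k) _

end Decomposition

/-- The characteristic function of a sum `∑ Z_k ^ σ * W_k`, when the `W_k` are independent of each
other and of `Z`. -/
theorem charFun_map_sum_rpow_mul {n : ℕ} {Ω : Type*} [MeasurableSpace Ω] {P : Measure Ω}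
    [IsProbabilityMeasure P] {Z : Ω → Fin n → ℝ} {W : Fin n → Ω → ℝ} {ζ : Measure (Fin n → ℝ)}
    {μ : Fin n → Measure ℝ} (hZ : HasLaw Z ζ P) (hW : ∀ k, HasLaw (W k) (μ k) P)
    (hind : iIndepFun W P) (hZW : IndepFun Z (fun ω k => W k ω) P) (σ t : ℝ) :
    charFun (P.map fun ω => ∑ k, Z ω k ^ σ * W k ω) t =
      ∫ z, ∏ k, charFun (μ k) (t * z k ^ σ) ∂ζ := by
  have hμ : ∀ k, IsProbabilityMeasure (μ k) := fun k => (hW k).isProbabilityMeasure_iff.1 ‹_›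
  have hζ : IsProbabilityMeasure ζ := hZ.isProbabilityMeasure_iff.1 ‹_›
  have hWm : AEMeasurable (fun ω k => W k ω) P := aemeasurable_pi_lambda _ fun k =>
    (hW k).aemeasurable
  have hWlaw : P.map (fun ω k => W k ω) = Measure.pi μ := by
    rw [(iIndepFun_iff_map_fun_eq_pi_map fun k => (hW k).aemeasurable).1 hind]
    congr with k : 1
    exact (hW k).map_eq
  have hjoint : P.map (fun ω => (Z ω, fun k => W k ω)) = ζ.prod (Measure.pi μ) := by
    rw [(indepFun_iff_map_prod_eq_prod_map_map hZ.aemeasurable hWm).1 hZW, hWlaw, hZ.map_eq]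
  have hf : Measurable fun p : (Fin n → ℝ) × (Fin n → ℝ) => ∑ k, p.1 k ^ σ * p.2 k := by
    fun_prop
  have hlaw : P.map (fun ω => ∑ k, Z ω k ^ σ * W k ω) =
      (ζ.prod (Measure.pi μ)).map fun p => ∑ k, p.1 k ^ σ * p.2 k := by
    rw [← hjoint, AEMeasurable.map_map_of_aemeasurable hf.aemeasurable
      (hZ.aemeasurable.prodMk hWm)]
    rfl
  have he : Continuous fun x : ℝ => Complex.exp (t * x * Complex.I) := by fun_prop
  rw [charFun_apply_real, hlaw, integral_map hf.aemeasurable he.aestronglyMeasurable,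
    integral_prod]
  · congr with z
    have h1 : ∀ w : Fin n → ℝ, Complex.exp (t * ↑(∑ k, z k ^ σ * w k) * Complex.I) =
        ∏ k, Complex.exp (↑(t * z k ^ σ) * w k * Complex.I) := by
      intro w
      rw [← Complex.exp_sum]
      congr 1
      push_cast
      rw [Finset.mul_sum, Finset.sum_mul]
      exact Finset.sum_congr rfl fun k _ => by ring
    simp only [h1]
    rw [integral_fintype_prod_eq_prod (𝕜 := ℂ)
      (fun k (x : ℝ) => Complex.exp (↑(t * z k ^ σ) * x * Complex.I))]
    simp only [charFun_apply_real]
  · refine .of_bound (C := 1) (he.measurable.comp hf).aestronglyMeasurable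
      (.of_forall fun p => ?_)
    rw [← Complex.ofReal_mul, Complex.norm_exp_ofReal_mul_I]

end PolyaUrn

/-! ### The main theorem. -/

theorem mainTheorem8 (a b c d : ℕ) (hbal : a + b = c + d) (hbc : b * c ≠ 0)
    (hlarge : 1 / 2 < PolyaUrn.ratio a b c) :
    (∀ α β : ℕ, (α, β) ≠ (0, 0) → ∀ᵐ U ∂(PolyaUrn.urnLaw a b c d α β),
      ∃ w : ℝ, Tendsto (PolyaUrn.scaled a b c U) atTop (𝓝 w)) ∧
    (∀ α β : ℕ, (α, β) ≠ (0, 0) →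
      ∀ (Ω : Type*) [MeasurableSpace Ω] (P : Measure Ω) [IsProbabilityMeasure P]
        (Z : Ω → Fin (α + β) → ℝ) (W : Fin (α + β) → Ω → ℝ),
        HasLaw Z (PolyaUrn.dirichlet (α + β) (fun _ => 1 / ((a : ℝ) + b))) P →
        (∀ i : Fin α, HasLaw (W (Fin.castAdd β i)) (PolyaUrn.limitLaw a b c d 1 0) P) →
        (∀ j : Fin β, HasLaw (W (Fin.natAdd α j)) (PolyaUrn.limitLaw a b c d 0 1) P) →
        iIndepFun W P →
        IndepFun Z (fun ω k => W k ω) P →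
        HasLaw
          (fun ω =>
            ∑ i : Fin α, Z ω (Fin.castAdd β i) ^ PolyaUrn.ratio a b c * W (Fin.castAdd β i) ω
            + ∑ j : Fin β, Z ω (Fin.natAdd α j) ^ PolyaUrn.ratio a b c * W (Fin.natAdd α j) ω)
          (PolyaUrn.limitLaw a b c d α β) P) := by
  have h : PolyaUrn.IsLarge a b c d :=
    ⟨hbal, left_ne_zero_of_mul hbc, right_ne_zero_of_mul hbc, hlarge⟩
  refine ⟨fun α β h0 => h.ae_tendsto (v := (α, β)) h0, ?_⟩
  intro α β h0 Ω _ P _ Z W hZ hW1 hW2 hind hZW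
  have := h.isProbabilityMeasure_limitLaw (v := (α, β)) h0
  -- The parts are the single balls, each of mass 1/S: hence the Dirichlet parameters.
  let v : Fin (α + β) → ℕ × ℕ := Fin.append (fun _ => (1, 0)) (fun _ => (0, 1))
  have hv : ∀ k, v k ≠ 0 := by
    intro k
    induction k using Fin.addCases <;> simp [v]
  have hmass : (fun k => PolyaUrn.mass a b (v k)) = fun _ => 1 / ((a : ℝ) + b) := by
    ext k
    induction k using Fin.addCases <;> simp [v, PolyaUrn.mass]
  have hsum : ∑ k, v k = (α, β) := by
    rw [Fin.sum_univ_add]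
    simp [v]
  have hW : ∀ k, HasLaw (W k) (PolyaUrn.limitLaw a b c d (v k).1 (v k).2) P := by
    intro k
    induction k using Fin.addCases with
    | left i => simpa [v] using hW1 i
    | right j => simpa [v] using hW2 j
  have hfun : (fun ω =>
      ∑ i : Fin α, Z ω (Fin.castAdd β i) ^ PolyaUrn.ratio a b c * W (Fin.castAdd β i) ω
      + ∑ j : Fin β, Z ω (Fin.natAdd α j) ^ PolyaUrn.ratio a b c * W (Fin.natAdd α j) ω) =
      fun ω => ∑ k, Z ω k ^ PolyaUrn.ratio a b c * W k ω := by
    ext ω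
    exact (Fin.sum_univ_add fun k => Z ω k ^ PolyaUrn.ratio a b c * W k ω).symm
  have hm : AEMeasurable (fun ω => ∑ k, Z ω k ^ PolyaUrn.ratio a b c * W k ω) P := by
    refine Finset.aemeasurable_fun_sum _ fun k _ => AEMeasurable.mul ?_ (hW k).aemeasurable
    exact ((measurable_pi_apply k).comp_aemeasurable hZ.aemeasurable).pow_const _
  rw [hfun]
  refine ⟨hm, ?_⟩
  have := Measure.isProbabilityMeasure_map hm
  refine Measure.ext_of_charFun (funext fun t => ?_)
  rw [PolyaUrn.charFun_map_sum_rpow_mul hZ hW hind hZW, ← hmass]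
  obtain ⟨n, hn⟩ : ∃ n, α + β = n + 1 := Nat.exists_eq_succ_of_ne_zero fun h1 => h0 (by
    rw [Nat.add_eq_zero_iff.1 h1 |>.1, Nat.add_eq_zero_iff.1 h1 |>.2])
  -- The dimension α + β is only propositionally a successor; a free N permits the substitution.
  have key : ∀ (N : ℕ) (hN : N = n + 1) (v : Fin N → ℕ × ℕ), (∀ k, v k ≠ 0) →
      ∫ z, ∏ k, charFun (PolyaUrn.limitLaw a b c d (v k).1 (v k).2)
          (t * z k ^ PolyaUrn.ratio a b c)
        ∂(PolyaUrn.dirichlet N fun k => PolyaUrn.mass a b (v k)) =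
      charFun (PolyaUrn.limitLaw a b c d (∑ k, v k).1 (∑ k, v k).2) t := by
    rintro N rfl v hv
    exact h.integral_dirichlet hv t
  rw [key _ hn v hv, hsum]
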